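/- Let $\gamma>0$ and let $g$ be a decreasing differentiable function on $[0,\infty)$ with bounded derivative and $-V^0\le g\le -v_0$ for some constants $v_0,V^0>0$. Consider the free interface problem of finding $u(x,t)$ and $s(t)=\int_0^t v(\tau)\,d\tau$ such that $$u_t=u_{xx}-\gamma u\ \ (x\neq s(t),\ t>0),\qquad u(x,0)=u^0(x)\ge 0,$$ $$g(u(s(t),t))=v(t),\qquad u_x^+(s(t),t)-u_x^-(s(t),t)=v(t),$$ where $u_x^{\pm}$ are the right and left derivatives at the interface. A solution on $(0,\sigma)$ means a bounded classical solution: $v$ is continuous on $[0,\sigma)$, $u$ is continuous and bounded on $\mathbb R\times[0,\sigma)$ with $u(s(t),t)\ge 0$, and for $0<t<\sigma$, $x\ne s(t)$ the derivatives $u_t,u_x,u_{xx}$ exist and are continuous. For $\alpha\ge0$ let $|f|_\alpha=\sup_{x\in\mathbb R}e^{\alpha|x|}|f(x)|$ and $C_\alpha=\{f\in C(\mathbb R):|f|_\alpha<\infty\}$, and let $\alpha_{space}=\min(v_0/4,\gamma/(2V^0))$. Let $0\le\alpha<\alpha_{space}$. There is a constant $c>0$ such that for every $R>0$ there is $\sigma>0$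 with the following property: if $u^0,\tilde u^0\in C_\alpha$ satisfy $|u^0|_\alpha,|\tilde u^0|_\alpha\le R$, and $(u,s)$, $(\tilde u,\tilde s)$ are solutions on $(0,\sigma)$ with initial data $u^0,\tilde u^0$ and interface velocities $V,\tilde V$, then $$\sup_{0<t<\sigma}|V(t)-\tilde V(t)|\le c\,|u^0-\tilde u^0|_\alpha,$$ and for all $0<t<\sigma$ the differences $u(\cdot+s(t),t)-\tilde u(\cdot+\tilde s(t),t)$ and $u(\cdot-s(t),t)-\tilde u(\cdot-\tilde s(t),t)$ belong to $C_\alpha$ and $$|u(\cdot+ s(t),t)-\tilde u(\cdot+\tilde s(t),t)|_\alpha\le c\,|u^0-\tilde u^0|_\alpha,\qquad |u(\cdot- s(t),t)-\tilde u(\cdot-\tilde s(t),t)|_\alpha\le c\,|u^0-\tilde u^0|_\alpha .$$ In particular, the solutions depend on the initial data uniformly continuously on balls of $C_\alpha$, locally in time. -/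

import Mathlib

noncomputable section

namespace Stefan

/-- Membership in the weighted space `C_α`: `f` is continuous on `ℝ` and
`sup_x e^{α|x|} |f x|` is finite. -/
def MemC (α : ℝ) (f : ℝ → ℝ) : Prop :=
  Continuous f ∧ BddAbove (Set.range fun x : ℝ => Real.exp (α * |x|) * |f x|)

/-- The weighted sup-norm `|f|_α = sup_x e^{α|x|} |f x|`
(the genuine supremum for `f` in `C_α`). -/
def wnorm (α : ℝ) (f : ℝ → ℝ) : ℝ :=
  ⨆ x : ℝ, Real.exp (α * |x|) * |f x|

/-- Assumptions on the kinetic function `g` on `[0, ∞)`: it is decreasing and differentiable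
with bounded derivative, and `-V⁰ ≤ g ≤ -v₀` with `v₀, V⁰ > 0`.
The values of `g` on negative numbers play no role. -/
structure IsKinetics (v₀ V₀ : ℝ) (g : ℝ → ℝ) : Prop where
  pos_lower : 0 < v₀
  pos_upper : 0 < V₀
  antitone : AntitoneOn g (Set.Ici 0)
  differentiable : DifferentiableOn ℝ g (Set.Ici 0)
  deriv_bdd : ∃ C : ℝ, ∀ y ∈ Set.Ici (0 : ℝ), |derivWithin g (Set.Ici 0) y| ≤ C
  bounds : ∀ y ∈ Set.Ici (0 : ℝ), -V₀ ≤ g y ∧ g y ≤ -v₀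

/-- The critical weight exponent `α_space = min (v₀ / 4, γ / (2 V⁰))`. -/
def alphaSpace (γ v₀ V₀ : ℝ) : ℝ := min (v₀ / 4) (γ / (2 * V₀))

/-- The part of the strip `ℝ × (0, σ)` off the interface `x = s(t)`; points are `(x, t)`. -/
def offInterface (σ : ℝ) (s : ℝ → ℝ) : Set (ℝ × ℝ) :=
  {p | 0 < p.2 ∧ p.2 < σ ∧ p.1 ≠ s p.2}

/-- `(u, s)` is a (bounded) classical solution on the time interval `(0, σ)`, with interface
velocity `v`, of the free interface problem
`u_t = u_xx - γ u` for `x ≠ s(t)`, `u(x, 0) = u₀(x) ≥ 0`,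
`g(u(s(t), t)) = v(t)`, `u_x⁺(s(t), t) - u_x⁻(s(t), t) = v(t)`, `s(t) = ∫₀ᵗ v`. -/
structure IsSolution (γ : ℝ) (g : ℝ → ℝ) (u₀ : ℝ → ℝ) (σ : ℝ)
    (u : ℝ → ℝ → ℝ) (s v : ℝ → ℝ) : Prop where
  /-- the velocity is continuous and the interface position is its primitive -/
  velocity_cont : ContinuousOn v (Set.Ico 0 σ)
  position : ∀ t ∈ Set.Ico 0 σ, s t = ∫ τ in (0 : ℝ)..t, v τ
  /-- the temperature is continuous up to `t = 0` and across the interface, and bounded -/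
  cont : ContinuousOn (fun p : ℝ × ℝ => u p.1 p.2) (Set.univ ×ˢ Set.Ico 0 σ)
  bdd : ∃ B : ℝ, ∀ x : ℝ, ∀ t ∈ Set.Ico 0 σ, |u x t| ≤ B
  /-- initial condition -/
  init_nonneg : ∀ x : ℝ, 0 ≤ u₀ x
  init : ∀ x : ℝ, u x 0 = u₀ x
  /-- `u` is of class `C^{2,1}` off the interface and solves the heat equation there
  (the continuity of `u_t` follows from the equation) -/
  space_smooth : ∀ p ∈ offInterface σ s, ContDiffAt ℝ 2 (fun x => u x p.2) p.1
  ux_cont : ContinuousOn (fun p : ℝ × ℝ => deriv (fun x => u x p.2) p.1) (offInterface σ s)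
  uxx_cont : ContinuousOn (fun p : ℝ × ℝ => iteratedDeriv 2 (fun x => u x p.2) p.1)
    (offInterface σ s)
  heat : ∀ p ∈ offInterface σ s,
    HasDerivAt (fun t => u p.1 t)
      (iteratedDeriv 2 (fun x => u x p.2) p.1 - γ * u p.1 p.2) p.2
  /-- kinetic condition; the interface temperature lies in the domain `[0, ∞)` of `g` -/
  interface_nonneg : ∀ t ∈ Set.Ioo 0 σ, 0 ≤ u (s t) t
  kinetic : ∀ t ∈ Set.Ioo 0 σ, g (u (s t) t) = v t
  /-- jump condition for the one-sided space derivatives at the interface -/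
  jump : ∀ t ∈ Set.Ioo 0 σ, ∃ uxp uxm : ℝ,
    HasDerivWithinAt (fun x => u x t) uxp (Set.Ioi (s t)) (s t) ∧
    HasDerivWithinAt (fun x => u x t) uxm (Set.Iio (s t)) (s t) ∧
    uxp - uxm = v t

end Stefan

end

noncomputable section

open Real MeasureTheory Filter Topology Set

namespace Stefan

/-! Multiplying by `e^{γ t}` removes the absorption term: `U = e^{γ t} u` solves the heat equation
off the interface and its gradient jumps there by `e^{γ t} v`. A bounded function with these
properties is determined by its initial values, the interface and the jump, so `U` is the heat flow
of the initial values minus a single layer potential with density `e^{γ t} v`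
(`eq_heatFlow_sub_layerPotential`, `IsSolution.representation`). This rests on the jump relation
`tendsto_symmetric_difference_layerPotential` and on the maximum principle
`nonpos_of_caloric_off_curve`.

Let `Δ` be the distance of the initial data and `M` the largest difference of the velocities. In
frames attached to the two interfaces the potentials see the curves only through `s(t) - s(t - θ)`.
These increments differ by at most `M θ`, and the factor `θ` cancels the singularity `1/θ` in the
bound for the kernel gradient. The fields therefore differ by at most `A₁ Δ + A₂ √t M`. At the
interface, the Lipschitz kinetics turn this into `M ≤ L A₁ Δ + L A₂ √t M`, and for short times the
last term is absorbed. The bound `R` enters only through terms carrying a factor `√t`, so it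
influences `σ` but not `c`.

For the reflected frame, `x - s = (x - 2 s) + s` leaves one more error: a translation of a single
field by `2 (s₁ - s₂)`, of size at most `2 M t`. The field is Lipschitz in space with constant of
order `t^{-1/2}`, across the interface too (`weight_mul_abs_generatedField_translate_le`), so this
error is again of order `√t M`.

The weight `e^{α|x|}` is absorbed everywhere by part of the Gaussian, at the price of factors
bounded for `t ≤ 1`. -/

/-! ### Heat kernel: derivatives and Gaussian bounds -/

/-- The one-dimensional heat kernel, extended by zero to non-positive times. -/
def heatKernel (z θ : ℝ) : ℝ := (√(4 * π * θ))⁻¹ * exp (-(z ^ 2 / (4 * θ)))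

/-- The first space derivative of the heat kernel. -/
def heatKernelX (z θ : ℝ) : ℝ := -(z / (2 * θ)) * heatKernel z θ

/-- The second space derivative of the heat kernel, which is also its time derivative. -/
def heatKernelXX (z θ : ℝ) : ℝ := (z ^ 2 / (4 * θ ^ 2) - 1 / (2 * θ)) * heatKernel z θ

/-- The extension by zero is produced by the conventions `√x = 0` for `x ≤ 0` and `0⁻¹ = 0`. -/
lemma heatKernel_of_nonpos (z : ℝ) {θ : ℝ} (hθ : θ ≤ 0) : heatKernel z θ = 0 := by
  have : 4 * π * θ ≤ 0 := mul_nonpos_of_nonneg_of_nonpos (by positivity) hθ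
  simp [heatKernel, sqrt_eq_zero_of_nonpos this]

lemma heatKernelX_of_nonpos (z : ℝ) {θ : ℝ} (hθ : θ ≤ 0) : heatKernelX z θ = 0 := by
  simp [heatKernelX, heatKernel_of_nonpos z hθ]

lemma heatKernelXX_of_nonpos (z : ℝ) {θ : ℝ} (hθ : θ ≤ 0) : heatKernelXX z θ = 0 := by
  simp [heatKernelXX, heatKernel_of_nonpos z hθ]

lemma heatKernel_nonneg (z θ : ℝ) : 0 ≤ heatKernel z θ := by
  unfold heatKernel; positivity

lemma measurable_heatKernel : Measurable fun p : ℝ × ℝ => heatKernel p.1 p.2 := by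
  unfold heatKernel; fun_prop

lemma measurable_heatKernelX : Measurable fun p : ℝ × ℝ => heatKernelX p.1 p.2 := by
  unfold heatKernelX heatKernel; fun_prop

lemma measurable_heatKernelXX : Measurable fun p : ℝ × ℝ => heatKernelXX p.1 p.2 := by
  unfold heatKernelXX heatKernel; fun_prop

lemma le_four_pi_mul {θ : ℝ} (hθ : 0 < θ) : θ ≤ 4 * π * θ := by
  nlinarith [pi_gt_three]

lemma hasDerivAt_heatKernel_space (z θ : ℝ) :
    HasDerivAt (fun z => heatKernel z θ) (heatKernelX z θ) z := by
  unfold heatKernelX heatKernel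
  have h : HasDerivAt (fun z : ℝ => -(z ^ 2 / (4 * θ))) (-(z / (2 * θ))) z := by
    refine ((hasDerivAt_pow 2 z).div_const (4 * θ)).neg.congr_deriv ?_
    rcases eq_or_ne θ 0 with rfl | h
    · simp
    · field_simp; norm_num; ring
  refine (h.exp.const_mul (√(4 * π * θ))⁻¹).congr_deriv ?_
  ring

lemma hasDerivAt_heatKernelX_space (z θ : ℝ) :
    HasDerivAt (fun z => heatKernelX z θ) (heatKernelXX z θ) z := by
  unfold heatKernelXX
  have h : HasDerivAt (fun z : ℝ => -(z / (2 * θ))) (-(1 / (2 * θ))) z :=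
    ((hasDerivAt_id z).div_const (2 * θ)).neg
  refine (h.mul (hasDerivAt_heatKernel_space z θ)).congr_deriv ?_
  unfold heatKernelX
  rcases eq_or_ne θ 0 with rfl | hθ
  · simp
  · field_simp; ring

lemma exp_neg_le_div_sq {X : ℝ} (hX : 0 < X) : exp (-X) ≤ 2 / X ^ 2 := by
  have := pow_div_factorial_le_exp X hX.le 2
  rw [exp_neg, inv_eq_one_div, div_le_div_iff₀ (exp_pos _) (by positivity)]
  norm_num [Nat.factorial] at this
  linarith

lemma heatKernel_le (z θ : ℝ) : heatKernel z θ ≤ (√θ)⁻¹ := by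
  unfold heatKernel
  rcases le_or_gt θ 0 with h | h
  · have := heatKernel_of_nonpos z h
    unfold heatKernel at this
    rw [this]; positivity
  · have h1 : exp (-(z ^ 2 / (4 * θ))) ≤ 1 := by
      apply exp_le_one_iff.2; have : 0 ≤ z ^ 2 / (4 * θ) := by positivity
      linarith
    calc _ ≤ (√θ)⁻¹ * 1 := by
          gcongr
          exact le_four_pi_mul (by assumption)
      _ = _ := mul_one _

/-- The Gaussian beats powers of `θ`; the resulting factor `θ√θ = o(θ)` makes the zero extension
differentiable in time at `θ = 0`. -/
lemma heatKernel_le_quartic {z θ : ℝ} (hz : z ≠ 0) (hθ : 0 < θ) :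
    heatKernel z θ ≤ 32 * θ * √θ / z ^ 4 := by
  have hz2 : 0 < z ^ 2 := by positivity
  have h1 := exp_neg_le_div_sq (X := z ^ 2 / (4 * θ)) (by positivity)
  have hs : 0 < √θ := sqrt_pos.2 hθ
  unfold heatKernel
  calc _ ≤ (√θ)⁻¹ * (2 / (z ^ 2 / (4 * θ)) ^ 2) := by
        gcongr
        exact le_four_pi_mul (by assumption)
    _ = 32 * θ ^ 2 / (√θ * z ^ 4) := by field_simp; norm_num
    _ = _ := by
      rw [div_eq_div_iff (by positivity) (by positivity)]
      have : √θ * √θ = θ := mul_self_sqrt hθ.le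
      linear_combination (-32) * θ * z ^ 4 * this

/-- Smoothness across `θ = 0` away from the origin allows time derivatives of the layer potential to
be taken under an integral over a fixed range of source times, with no boundary term. -/
lemma hasDerivAt_heatKernel_time {z θ : ℝ} (h : z ≠ 0 ∨ θ ≠ 0) :
    HasDerivAt (fun θ => heatKernel z θ) (heatKernelXX z θ) θ := by
  rcases lt_trichotomy θ 0 with hθ | rfl | hθ
  · rw [heatKernelXX_of_nonpos z hθ.le]
    apply (hasDerivAt_const θ (0 : ℝ)).congr_of_eventuallyEq
    filter_upwards [eventually_lt_nhds hθ] with y hy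
    exact heatKernel_of_nonpos z hy.le
  · have hz : z ≠ 0 := by simpa using h
    rw [heatKernelXX_of_nonpos z le_rfl, hasDerivAt_iff_isLittleO]
    simp only [heatKernel_of_nonpos z le_rfl, sub_zero, smul_zero]
    rw [Asymptotics.isLittleO_iff]
    intro c hc
    have ht : Tendsto (fun θ : ℝ => 32 * √θ / z ^ 4) (𝓝 0) (𝓝 0) := by
      have : Continuous (fun θ : ℝ => 32 * √θ / z ^ 4) := by fun_prop
      simpa using this.tendsto 0
    filter_upwards [ht.eventually (gt_mem_nhds hc)] with θ hθ
    rw [norm_of_nonneg (heatKernel_nonneg _ _), norm_eq_abs]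
    rcases le_or_gt θ 0 with h0 | h0
    · rw [heatKernel_of_nonpos z h0]; positivity
    · rw [abs_of_pos h0]
      calc _ ≤ _ := heatKernel_le_quartic hz h0
        _ = 32 * √θ / z ^ 4 * θ := by ring
        _ ≤ _ := by gcongr
  · unfold heatKernelXX heatKernel
    have hp : 0 < 4 * π * θ := by positivity
    have h1 : HasDerivAt (fun θ : ℝ => (√(4 * π * θ))⁻¹)
        (-(4 * π * 1 / (2 * √(4 * π * θ))) / √(4 * π * θ) ^ 2) θ := by
      exact (((hasDerivAt_id θ).const_mul (4 * π)).sqrt hp.ne').inv (sqrt_pos.2 hp).ne'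
    have h2 : HasDerivAt (fun θ : ℝ => exp (-(z ^ 2 / (4 * θ))))
        (exp (-(z ^ 2 / (4 * θ))) * (z ^ 2 / (4 * θ ^ 2))) θ := by
      apply HasDerivAt.exp
      have := ((hasDerivAt_id θ).const_mul 4).inv (by positivity : 4 * id θ ≠ 0)
      have := (this.const_mul (z ^ 2)).neg
      refine this.congr_deriv ?_
      simp only [id]; field_simp
    refine (h1.mul h2).congr_deriv ?_
    rw [sq_sqrt hp.le]
    have : √(4 * π * θ) ≠ 0 := (sqrt_pos.2 hp).ne'
    field_simp
    ring

/-- Completing the square, half of the exponent `z²/(4θ)` pays for the weight. Half of the remainder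
pays for the factor `|z|`, which becomes `2√θ`, and `exp (-(z²/(16θ)))` survives for integration in
space. -/
lemma weight_mul_abs_heatKernelX_le {α : ℝ} (z : ℝ) {θ : ℝ} (hθ : 0 < θ) :
    exp (α * |z|) * |heatKernelX z θ| ≤ exp (2 * α ^ 2 * θ) * exp (-(z ^ 2 / (16 * θ))) / θ := by
  have hs : 0 < √θ := sqrt_pos.2 hθ
  have hs2 : √θ ^ 2 = θ := sq_sqrt hθ.le
  have e1 : α * |z| + -(z ^ 2 / (4 * θ)) ≤ 2 * α ^ 2 * θ + -(z ^ 2 / (8 * θ)) := by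
    have : 2 * α ^ 2 * θ - α * |z| + z ^ 2 / (8 * θ) = (4 * α * θ - |z|) ^ 2 / (8 * θ) := by
      field_simp
      rw [← sq_abs z]; ring
    have h2 : 0 ≤ (4 * α * θ - |z|) ^ 2 / (8 * θ) := by positivity
    have h3 : z ^ 2 / (4 * θ) = z ^ 2 / (8 * θ) + z ^ 2 / (8 * θ) := by field_simp; ring
    linarith
  have e2 : |z| * exp (-(z ^ 2 / (16 * θ))) ≤ 2 * √θ := by
    rw [exp_neg, ← div_eq_mul_inv, div_le_iff₀ (exp_pos _)]
    have h1 := add_one_le_exp (z ^ 2 / (16 * θ))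
    calc |z| ≤ 2 * √θ * (z ^ 2 / (16 * θ) + 1) := by
          have : 2 * √θ * (z ^ 2 / (16 * θ) + 1) - |z| =
              ((|z| - 4 * √θ) ^ 2) / (8 * √θ) := by
            have : θ = √θ ^ 2 := hs2.symm
            rw [← sq_abs z]
            rw [this, sqrt_sq hs.le]; field_simp; ring
          have h2 : 0 ≤ ((|z| - 4 * √θ) ^ 2) / (8 * √θ) := by positivity
          linarith
      _ ≤ _ := by gcongr
  have e3 : exp (-(z ^ 2 / (8 * θ))) = exp (-(z ^ 2 / (16 * θ))) * exp (-(z ^ 2 / (16 * θ))) := by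
    rw [← exp_add]; congr 1; field_simp; ring
  unfold heatKernelX heatKernel
  rw [abs_mul, abs_neg, abs_div, abs_of_pos (by positivity : 0 < 2 * θ), abs_mul,
    abs_of_pos (exp_pos _), abs_of_nonneg (by positivity : 0 ≤ (√(4 * π * θ))⁻¹)]
  calc _ = |z| / (2 * θ) * (√(4 * π * θ))⁻¹ * (exp (α * |z|) * exp (-(z ^ 2 / (4 * θ)))) := by ring
    _ ≤ |z| / (2 * θ) * (√θ)⁻¹ * (exp (2 * α ^ 2 * θ) * exp (-(z ^ 2 / (8 * θ)))) := by
        rw [← exp_add, ← exp_add]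
        gcongr
        exact le_four_pi_mul (by assumption)
    _ = (|z| * exp (-(z ^ 2 / (16 * θ)))) *
          (exp (2 * α ^ 2 * θ) * exp (-(z ^ 2 / (16 * θ))) / (2 * θ * √θ)) := by
        rw [e3]; field_simp
    _ ≤ (2 * √θ) * (exp (2 * α ^ 2 * θ) * exp (-(z ^ 2 / (16 * θ))) / (2 * θ * √θ)) := by gcongr
    _ = _ := by field_simp

lemma weight_mul_heatKernel_le {α : ℝ} (z : ℝ) {θ : ℝ} (hθ : 0 < θ) :
    exp (α * |z|) * heatKernel z θ ≤ exp (α ^ 2 * θ) * (√θ)⁻¹ := by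
  have e1 : α * |z| + -(z ^ 2 / (4 * θ)) ≤ α ^ 2 * θ := by
    have : α ^ 2 * θ - α * |z| + z ^ 2 / (4 * θ) = (2 * α * θ - |z|) ^ 2 / (4 * θ) := by
      field_simp
      rw [← sq_abs z]; ring
    have h2 : 0 ≤ (2 * α * θ - |z|) ^ 2 / (4 * θ) := by positivity
    linarith
  unfold heatKernel
  calc _ = (√(4 * π * θ))⁻¹ * (exp (α * |z|) * exp (-(z ^ 2 / (4 * θ)))) := by ring
    _ ≤ (√θ)⁻¹ * exp (α ^ 2 * θ) := by
      rw [← exp_add]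
      gcongr
      exact le_four_pi_mul (by assumption)
    _ = _ := by ring

lemma mul_exp_neg_le {X : ℝ} (hX : 0 ≤ X) : X * exp (-X) ≤ exp (-(X / 2)) := by
  have h3 : X ≤ exp (X / 2) := by
    have h4 := quadratic_le_exp_of_nonneg (x := X / 2) (by positivity)
    nlinarith [sq_nonneg (X - 2)]
  calc X * exp (-X) ≤ exp (X / 2) * exp (-X) := by gcongr
    _ = _ := by rw [← exp_add]; ring_nf

lemma abs_heatKernelXX_le (z : ℝ) {θ : ℝ} (hθ : 0 < θ) :
    |heatKernelXX z θ| ≤ 2 * exp (-(z ^ 2 / (8 * θ))) / (θ * √θ) := by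
  have hs : 0 < √θ := sqrt_pos.2 hθ
  have hX : 0 ≤ z ^ 2 / (4 * θ) := by positivity
  have h1 := mul_exp_neg_le hX
  have h2 : z ^ 2 / (4 * θ) / 2 = z ^ 2 / (8 * θ) := by field_simp; ring
  rw [h2] at h1
  have h3 : exp (-(z ^ 2 / (4 * θ))) ≤ exp (-(z ^ 2 / (8 * θ))) := by
    apply exp_le_exp.2; rw [← h2]; linarith
  unfold heatKernelXX heatKernel
  have h4 : |z ^ 2 / (4 * θ ^ 2) - 1 / (2 * θ)| ≤ (z ^ 2 / (4 * θ) + 1) / θ := by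
    have e : z ^ 2 / (4 * θ ^ 2) = z ^ 2 / (4 * θ) / θ := by field_simp
    have e' : 1 / (2 * θ) = (1 / 2) / θ := by field_simp
    rw [e, e', ← sub_div, abs_div, abs_of_pos hθ]
    gcongr
    rw [abs_le]; constructor <;> linarith
  rw [abs_mul, abs_mul, abs_of_pos (exp_pos _), abs_of_nonneg (by positivity : 0 ≤ (√(4 * π * θ))⁻¹)]
  calc _ ≤ (z ^ 2 / (4 * θ) + 1) / θ * ((√θ)⁻¹ * exp (-(z ^ 2 / (4 * θ)))) := by
        gcongr
        exact le_four_pi_mul (by assumption)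
    _ = (z ^ 2 / (4 * θ) * exp (-(z ^ 2 / (4 * θ))) + exp (-(z ^ 2 / (4 * θ)))) / (θ * √θ) := by
        field_simp
    _ ≤ (exp (-(z ^ 2 / (8 * θ))) + exp (-(z ^ 2 / (8 * θ)))) / (θ * √θ) := by gcongr
    _ = _ := by ring

lemma abs_heatKernelX_le (z : ℝ) {θ : ℝ} (hθ : 0 < θ) :
    |heatKernelX z θ| ≤ exp (-(z ^ 2 / (16 * θ))) / θ := by
  simpa using weight_mul_abs_heatKernelX_le (α := 0) z hθ

/-- The only singularity is the space-time origin: for large `θ` the prefactors are bounded, and for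
small `θ` the Gaussian compensates them once `|z| ≥ ρ`. -/
lemma exists_bound_away_from_origin {ρ : ℝ} (hρ : 0 < ρ) :
    ∃ C, ∀ z θ : ℝ, (ρ ≤ |z| ∨ ρ ≤ |θ|) →
      |heatKernel z θ| ≤ C ∧ |heatKernelX z θ| ≤ C ∧ |heatKernelXX z θ| ≤ C := by
  have hs : 0 < √ρ := sqrt_pos.2 hρ
  set A := (√ρ)⁻¹
  set B := 1 / ρ
  set C := 2 / (ρ * √ρ)
  set D := 32 * ρ * √ρ / ρ ^ 4
  set E := 16 / ρ ^ 2
  set F := 256 * √ρ / ρ ^ 4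
  have hA : 0 ≤ A := by positivity
  have hB : 0 ≤ B := by positivity
  have hC : 0 ≤ C := by positivity
  have hD : 0 ≤ D := by positivity
  have hE : 0 ≤ E := by positivity
  have hF : 0 ≤ F := by positivity
  refine ⟨A + B + C + D + E + F, fun z θ h => ?_⟩
  rcases le_or_gt θ 0 with h0 | h0
  · simp only [heatKernel_of_nonpos z h0, heatKernelX_of_nonpos z h0, heatKernelXX_of_nonpos z h0,
      abs_zero, and_self]
    positivity
  have one (c : ℝ) (hc : 0 < c) : exp (-(z ^ 2 / (c * θ))) ≤ 1 := by
    apply exp_le_one_iff.2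
    have : 0 ≤ z ^ 2 / (c * θ) := by positivity
    linarith
  rw [abs_of_pos h0] at h
  rcases le_or_gt ρ θ with h1 | h1
  · have a1 : |heatKernel z θ| ≤ A := by
      rw [abs_of_nonneg (heatKernel_nonneg _ _)]
      exact (heatKernel_le z θ).trans (inv_anti₀ hs (sqrt_le_sqrt h1))
    have a2 : |heatKernelX z θ| ≤ B := by
      refine (abs_heatKernelX_le z h0).trans ?_
      exact div_le_div₀ zero_le_one (one 16 (by norm_num)) hρ h1
    have a3 : |heatKernelXX z θ| ≤ C := by
      refine (abs_heatKernelXX_le z h0).trans ?_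
      refine div_le_div₀ zero_le_two ?_ (by positivity) ?_
      · linarith [one 8 (by norm_num)]
      · gcongr
    refine ⟨?_, ?_, ?_⟩ <;> linarith
  · have hz : ρ ≤ |z| := by rcases h with h | h <;> [exact h; linarith]
    have hz0 : z ≠ 0 := abs_pos.1 (hρ.trans_le hz)
    have hz4 : ρ ^ 4 ≤ z ^ 4 := by
      rw [← Even.pow_abs (by decide : Even 4) z]; gcongr
    have hz2 : ρ ^ 2 ≤ z ^ 2 := by
      rw [← sq_abs z]; gcongr
    have hzp : 0 < z ^ 2 := by positivity
    have a1 : |heatKernel z θ| ≤ D := by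
      rw [abs_of_nonneg (heatKernel_nonneg _ _)]
      refine (heatKernel_le_quartic hz0 h0).trans ?_
      show _ ≤ 32 * ρ * √ρ / ρ ^ 4
      gcongr
    have a2 : |heatKernelX z θ| ≤ E := by
      refine (abs_heatKernelX_le z h0).trans ?_
      have hX : 0 < z ^ 2 / (16 * θ) := by positivity
      have : exp (-(z ^ 2 / (16 * θ))) ≤ 1 / (z ^ 2 / (16 * θ)) := by
        rw [exp_neg, inv_eq_one_div]
        apply one_div_le_one_div_of_le hX
        linarith [add_one_le_exp (z ^ 2 / (16 * θ))]
      calc _ ≤ 1 / (z ^ 2 / (16 * θ)) / θ := by gcongr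
        _ = 16 / z ^ 2 := by field_simp
        _ ≤ 16 / ρ ^ 2 := by gcongr
    have a3 : |heatKernelXX z θ| ≤ F := by
      refine (abs_heatKernelXX_le z h0).trans ?_
      have := exp_neg_le_div_sq (X := z ^ 2 / (8 * θ)) (by positivity)
      have hsθ : 0 < √θ := sqrt_pos.2 h0
      have hq : √θ * √θ = θ := mul_self_sqrt h0.le
      calc _ ≤ 2 * (2 / (z ^ 2 / (8 * θ)) ^ 2) / (θ * √θ) := by gcongr
        _ = 256 * θ / (z ^ 4 * √θ) := by field_simp; norm_num
        _ = 256 * √θ / z ^ 4 := by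
          rw [div_eq_div_iff (by positivity) (by positivity)]
          linear_combination (-256) * z ^ 4 * hq
        _ ≤ 256 * √ρ / ρ ^ 4 := by gcongr
    refine ⟨?_, ?_, ?_⟩ <;> linarith

/-! ### Superpositions of heat kernels and a weak form of the heat equation -/

/-- Differentiation of a superposition of heat kernels, under a local domination hypothesis. -/
lemma hasDerivAt_superposition {Ω : Type*} [MeasurableSpace Ω] {μ : Measure Ω} {ξ η β bound : Ω → ℝ}
    (hξ : Measurable ξ) (hη : Measurable η) (hβ : Measurable β) {x₀ t₀ ρ : ℝ} (hρ : 0 < ρ)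
    (hb : Integrable bound μ)
    (h : ∀ p, ∀ x ∈ Metric.ball x₀ ρ, ∀ t ∈ Metric.ball t₀ ρ,
      (x - ξ p ≠ 0 ∨ t - η p ≠ 0) ∧ |heatKernel (x - ξ p) (t - η p) * β p| ≤ bound p ∧
      |heatKernelX (x - ξ p) (t - η p) * β p| ≤ bound p ∧
      |heatKernelXX (x - ξ p) (t - η p) * β p| ≤ bound p) :
    (∀ x ∈ Metric.ball x₀ ρ,
      HasDerivAt (fun x => ∫ p, heatKernel (x - ξ p) (t₀ - η p) * β p ∂μ)
        (∫ p, heatKernelX (x - ξ p) (t₀ - η p) * β p ∂μ) x) ∧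
    HasDerivAt (fun x => ∫ p, heatKernelX (x - ξ p) (t₀ - η p) * β p ∂μ)
      (∫ p, heatKernelXX (x₀ - ξ p) (t₀ - η p) * β p ∂μ) x₀ ∧
    HasDerivAt (fun t => ∫ p, heatKernel (x₀ - ξ p) (t - η p) * β p ∂μ)
      (∫ p, heatKernelXX (x₀ - ξ p) (t₀ - η p) * β p ∂μ) t₀ := by
  have ht₀ : t₀ ∈ Metric.ball t₀ ρ := Metric.mem_ball_self hρ
  have hx₀ : x₀ ∈ Metric.ball x₀ ρ := Metric.mem_ball_self hρ
  have m0 (x t : ℝ) : Measurable fun p => heatKernel (x - ξ p) (t - η p) * β p :=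
    (measurable_heatKernel.comp ((hξ.const_sub x).prodMk (hη.const_sub t))).mul hβ
  have m1 (x t : ℝ) : Measurable fun p => heatKernelX (x - ξ p) (t - η p) * β p :=
    (measurable_heatKernelX.comp ((hξ.const_sub x).prodMk (hη.const_sub t))).mul hβ
  have m2 (x t : ℝ) : Measurable fun p => heatKernelXX (x - ξ p) (t - η p) * β p :=
    (measurable_heatKernelXX.comp ((hξ.const_sub x).prodMk (hη.const_sub t))).mul hβ
  refine ⟨fun x hx => ?_, ?_, ?_⟩
  · refine (hasDerivAt_integral_of_dominated_loc_of_deriv_le (bound := bound)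
      (F' := fun x p => heatKernelX (x - ξ p) (t₀ - η p) * β p) (Metric.isOpen_ball.mem_nhds hx)
      (.of_forall fun x => (m0 x t₀).aestronglyMeasurable)
      (hb.mono' (m0 x t₀).aestronglyMeasurable (.of_forall fun p => (h p x hx t₀ ht₀).2.1))
      (m1 x t₀).aestronglyMeasurable
      (.of_forall fun p y hy => (h p y hy t₀ ht₀).2.2.1) hb
      (.of_forall fun p y hy => ?_)).2
    exact ((hasDerivAt_heatKernel_space (y - ξ p) (t₀ - η p)).comp_sub_const y (ξ p)).mul_const _
  · refine (hasDerivAt_integral_of_dominated_loc_of_deriv_le (bound := bound)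
      (F' := fun x p => heatKernelXX (x - ξ p) (t₀ - η p) * β p) (Metric.ball_mem_nhds x₀ hρ)
      (.of_forall fun x => (m1 x t₀).aestronglyMeasurable)
      (hb.mono' (m1 x₀ t₀).aestronglyMeasurable (.of_forall fun p => (h p x₀ hx₀ t₀ ht₀).2.2.1))
      (m2 x₀ t₀).aestronglyMeasurable
      (.of_forall fun p y hy => (h p y hy t₀ ht₀).2.2.2) hb
      (.of_forall fun p y hy => ?_)).2
    exact ((hasDerivAt_heatKernelX_space (y - ξ p) (t₀ - η p)).comp_sub_const y (ξ p)).mul_const _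
  · refine (hasDerivAt_integral_of_dominated_loc_of_deriv_le (bound := bound)
      (F' := fun t p => heatKernelXX (x₀ - ξ p) (t - η p) * β p) (Metric.ball_mem_nhds t₀ hρ)
      (.of_forall fun t => (m0 x₀ t).aestronglyMeasurable)
      (hb.mono' (m0 x₀ t₀).aestronglyMeasurable (.of_forall fun p => (h p x₀ hx₀ t₀ ht₀).2.1))
      (m2 x₀ t₀).aestronglyMeasurable
      (.of_forall fun p y hy => (h p x₀ hx₀ y hy).2.2.2) hb
      (.of_forall fun p y hy => ?_)).2
    exact ((hasDerivAt_heatKernel_time (h p x₀ hx₀ y hy).1).comp_sub_const y (η p)).mul_const _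

/-- `F` satisfies the heat equation at `(x, t)`, with the second space derivative understood as
the limit of symmetric second difference quotients. -/
def CaloricAt (F : ℝ → ℝ → ℝ) (x t : ℝ) : Prop :=
  ∃ d, Tendsto (fun r => (F (x + r) t + F (x - r) t - 2 * F x t) / r ^ 2) (𝓝[>] 0) (𝓝 d) ∧
    HasDerivAt (F x) d t

lemma CaloricAt.sub {F K : ℝ → ℝ → ℝ} {x t : ℝ} (hF : CaloricAt F x t) (hK : CaloricAt K x t) :
    CaloricAt (fun x t => F x t - K x t) x t := by
  obtain ⟨d, h1, h2⟩ := hF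
  obtain ⟨e, h3, h4⟩ := hK
  refine ⟨d - e, (h1.sub h3).congr fun r => ?_, h2.sub h4⟩
  rw [← sub_div]; congr 1; ring

/-- One application of L'Hôpital's rule leads to `(f' (x + r) - f' (x - r)) / (2 r)`, the mean of
two one-sided difference quotients of `f'`. Symmetric differences suffice for the maximum principle,
since they have a sign at a maximum. -/
lemma tendsto_symmetric_second_difference {f f' : ℝ → ℝ} {x d : ℝ}
    (h1 : ∀ᶠ y in 𝓝 x, HasDerivAt f (f' y) y) (h2 : HasDerivAt f' d x) :
    Tendsto (fun r => (f (x + r) + f (x - r) - 2 * f x) / r ^ 2) (𝓝[>] 0) (𝓝 d) := by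
  have tp : Tendsto (fun r : ℝ => x + r) (𝓝[>] 0) (𝓝 x) := by
    have : Continuous fun r : ℝ => x + r := by fun_prop
    simpa using this.continuousWithinAt (s := Ioi 0) (x := 0) |>.tendsto
  have tm : Tendsto (fun r : ℝ => x - r) (𝓝[>] 0) (𝓝 x) := by
    have : Continuous fun r : ℝ => x - r := by fun_prop
    simpa using this.continuousWithinAt (s := Ioi 0) (x := 0) |>.tendsto
  have hc : ContinuousAt f x := h1.self_of_nhds.continuousAt
  refine HasDerivAt.lhopital_zero_nhdsGT (f' := fun r => f' (x + r) - f' (x - r))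
    (g' := fun r => 2 * r) ?_ ?_ ?_ ?_ ?_ ?_
  · filter_upwards [tp.eventually h1, tm.eventually h1] with r hp hm
    have a := hp.comp_const_add x r
    have b := hm.comp_const_sub x r
    exact ((a.add b).sub_const _).congr_deriv (by ring)
  · exact .of_forall fun r => (hasDerivAt_pow 2 r).congr_deriv (by simp)
  · filter_upwards [self_mem_nhdsWithin] with r hr
    have : (0 : ℝ) < r := hr
    positivity
  · have := ((hc.tendsto.comp tp).add (hc.tendsto.comp tm)).sub_const (2 * f x)
    rwa [show f x + f x - 2 * f x = 0 by ring] at this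
  · have : Continuous fun r : ℝ => r ^ 2 := by fun_prop
    simpa using this.continuousWithinAt (s := Ioi 0) (x := 0) |>.tendsto
  · have a := (h2.tendsto_slope_zero_right)
    have b := (h2.tendsto_slope_zero_left)
    have neg : Tendsto (fun r : ℝ => -r) (𝓝[>] 0) (𝓝[<] 0) := by
      simpa using tendsto_neg_nhdsGT (a := (0 : ℝ))
    have := ((a.add (b.comp neg)).div_const 2)
    refine (this.congr' ?_).trans (by simp)
    filter_upwards [self_mem_nhdsWithin] with r hr
    have : r ≠ 0 := ne_of_gt hr
    simp only [Function.comp, smul_eq_mul, ← sub_eq_add_neg]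
    field_simp
    ring

/-! ### Heat flow on the line -/

/-- The solution of the heat equation on the line with initial values `f`. -/
def heatFlow (f : ℝ → ℝ) (x t : ℝ) : ℝ := (√π)⁻¹ * ∫ z, f (x + 2 * √t * z) * exp (-z ^ 2)

lemma integrable_exp_neg_sq : Integrable fun z : ℝ => exp (-z ^ 2) := by
  simpa using integrable_exp_neg_mul_sq (b := 1) one_pos

lemma integral_exp_neg_sq : ∫ z : ℝ, exp (-z ^ 2) = √π := by
  simpa using integral_gaussian 1

lemma heatFlow_zero (f : ℝ → ℝ) (x : ℝ) : heatFlow f x 0 = f x := by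
  have : √π ≠ 0 := (sqrt_pos.2 pi_pos).ne'
  simp only [heatFlow, sqrt_zero, mul_zero, zero_mul, add_zero]
  rw [integral_const_mul, integral_exp_neg_sq]
  field_simp

lemma integrable_heatFlow {f : ℝ → ℝ} (hf : Continuous f) {B : ℝ} (hB : ∀ x, |f x| ≤ B) (x t : ℝ) :
    Integrable fun z => f (x + 2 * √t * z) * exp (-z ^ 2) := by
  refine (integrable_exp_neg_sq.const_mul B).mono' (by fun_prop) (.of_forall fun z => ?_)
  rw [norm_mul, norm_of_nonneg (exp_pos _).le, norm_eq_abs]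
  gcongr
  exact hB _

lemma heatFlow_sub {f k : ℝ → ℝ} (hf : Continuous f) (hk : Continuous k) {B : ℝ}
    (hB : ∀ x, |f x| ≤ B) (hB' : ∀ x, |k x| ≤ B) (x t : ℝ) :
    heatFlow (fun x => f x - k x) x t = heatFlow f x t - heatFlow k x t := by
  unfold heatFlow
  rw [← mul_sub, ← integral_sub (integrable_heatFlow hf hB x t) (integrable_heatFlow hk hB' x t)]
  simp only [sub_mul]

/-- Moving the weight from `x` to `x + 2√t z` costs `exp (2α√t|z|)`, at most `exp (2α²t + z²/2)`.
What remains is the Gaussian `exp (-z²/2)`, whose wider integral produces the `√2`. -/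
lemma weight_mul_abs_heatFlow_le {f : ℝ → ℝ} {α N : ℝ} (hα : 0 ≤ α)
    (hN : ∀ x, exp (α * |x|) * |f x| ≤ N) (x : ℝ) {t : ℝ} (ht : 0 ≤ t) :
    exp (α * |x|) * |heatFlow f x t| ≤ √2 * exp (2 * α ^ 2 * t) * N := by
  have hi : Integrable fun z : ℝ => exp (-(1 / 2) * z ^ 2) :=
    integrable_exp_neg_mul_sq (by norm_num)
  have hsp : 0 < √π := sqrt_pos.2 pi_pos
  have key : ‖∫ z, f (x + 2 * √t * z) * exp (-z ^ 2)‖ ≤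
      ∫ z : ℝ, exp (-(α * |x|)) * (exp (2 * α ^ 2 * t) * N) * exp (-(1 / 2) * z ^ 2) := by
    refine norm_integral_le_of_norm_le (hi.const_mul _) (.of_forall fun z => ?_)
    set y := x + 2 * √t * z
    have hN0 : 0 ≤ N := le_trans (by positivity) (hN 0)
    have h1 : |x| ≤ |y| + 2 * √t * |z| := by
      have : x = y - 2 * √t * z := by simp [y]
      calc |x| = |y - 2 * √t * z| := by rw [← this]
        _ ≤ |y| + |2 * √t * z| := abs_sub _ _
        _ = _ := by rw [abs_mul, abs_of_nonneg (by positivity : 0 ≤ 2 * √t)]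
    have h2 : |f y| ≤ N * exp (-(α * |y|)) := by
      rw [exp_neg, ← div_eq_mul_inv, le_div_iff₀ (exp_pos _), mul_comm]
      exact hN y
    have h3 : α * (2 * √t * |z|) ≤ 2 * α ^ 2 * t + 1 / 2 * z ^ 2 := by
      have := sq_sqrt ht
      rw [← sq_abs z]
      nlinarith [sq_nonneg (2 * α * √t - |z|)]
    rw [norm_mul, norm_of_nonneg (exp_pos _).le, norm_eq_abs]
    calc |f y| * exp (-z ^ 2) ≤ N * exp (-(α * |y|)) * exp (-z ^ 2) := by gcongr
      _ = N * exp (-(α * |y|) + -z ^ 2) := by rw [exp_add]; ring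
      _ ≤ N * exp (-(α * |x|) + 2 * α ^ 2 * t + -(1 / 2) * z ^ 2) := by
        gcongr N * exp ?_
        have := mul_le_mul_of_nonneg_left h1 hα
        linarith
      _ = _ := by rw [exp_add, exp_add]; ring
  rw [integral_const_mul, integral_gaussian, norm_eq_abs] at key
  have e : √(π / (1 / 2)) = √2 * √π := by rw [← sqrt_mul zero_le_two]; congr 1; ring
  rw [e] at key
  unfold heatFlow
  rw [abs_mul, abs_of_pos (inv_pos.2 hsp)]
  calc _ ≤ exp (α * |x|) * ((√π)⁻¹ *
        (exp (-(α * |x|)) * (exp (2 * α ^ 2 * t) * N) * (√2 * √π))) := by gcongr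
    _ = (exp (α * |x|) * exp (-(α * |x|))) * (√2 * exp (2 * α ^ 2 * t) * N) := by field_simp
    _ = _ := by rw [← exp_add]; simp

/-- In the rescaled variable `z` the Gaussian does not depend on `t`, so one majorant serves all
times and continuity reaches `t = 0`. -/
lemma continuous_heatFlow {f : ℝ → ℝ} (hf : Continuous f) {B : ℝ} (hB : ∀ x, |f x| ≤ B) :
    Continuous fun p : ℝ × ℝ => heatFlow f p.1 p.2 := by
  unfold heatFlow
  refine continuous_const.mul ?_
  refine continuous_of_dominated (bound := fun z => B * exp (-z ^ 2)) (fun p => by fun_prop)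
    (fun p => .of_forall fun z => ?_) (integrable_exp_neg_sq.const_mul B)
    (.of_forall fun z => by fun_prop)
  rw [norm_mul, norm_of_nonneg (exp_pos _).le, norm_eq_abs]
  gcongr
  exact hB _

lemma heatFlow_eq (f : ℝ → ℝ) (x : ℝ) {t : ℝ} (ht : 0 < t) :
    heatFlow f x t = ∫ y, heatKernel (x - y) (t - 0) * f y := by
  have hs : 0 < √t := sqrt_pos.2 ht
  unfold heatFlow
  have h1 : ∀ z : ℝ, f (x + 2 * √t * z) * exp (-z ^ 2) =
      (fun w => f (x + w) * exp (-(w ^ 2 / (4 * t)))) (2 * √t * z) := by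
    intro z
    simp only
    congr 2
    rw [mul_pow, mul_pow, sq_sqrt ht.le]; field_simp; norm_num
  rw [integral_congr_ae (.of_forall h1), Measure.integral_comp_mul_left (fun w => f (x + w) * exp (-(w ^ 2 / (4 * t)))),
    ← integral_sub_right_eq_self (fun w => f (x + w) * exp (-(w ^ 2 / (4 * t)))) x,
    smul_eq_mul, ← mul_assoc, ← integral_const_mul]
  refine integral_congr_ae (.of_forall fun y => ?_)
  simp only [heatKernel, sub_zero]
  rw [abs_of_pos (by positivity), add_sub_cancel, ← neg_sub x y, neg_sq]
  have : √(4 * π * t) = √π * (2 * √t) := by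
    rw [show 4 * π * t = π * (2 ^ 2 * t) by ring, sqrt_mul pi_pos.le, sqrt_mul (by norm_num),
      sqrt_sq zero_le_two]
  rw [this, mul_inv]; ring

lemma hasDerivAt_heatFlow {f : ℝ → ℝ} (hf : Continuous f) {B : ℝ} (hB : ∀ x, |f x| ≤ B)
    (x₀ : ℝ) {t₀ : ℝ} (ht₀ : 0 < t₀) :
    HasDerivAt (fun x => heatFlow f x t₀) (∫ y, heatKernelX (x₀ - y) t₀ * f y) x₀ ∧
      CaloricAt (heatFlow f) x₀ t₀ := by
  have hB0 : 0 ≤ B := (abs_nonneg _).trans (hB 0)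
  set ρ := min 1 (t₀ / 2) with hρ
  have hρ0 : 0 < ρ := lt_min one_pos (by positivity)
  set θ₁ := t₀ / 2 with hθ₁
  have hθ₁0 : 0 < θ₁ := by positivity
  have hs1 : 0 < √θ₁ := sqrt_pos.2 hθ₁0
  set C := (√θ₁)⁻¹ + 1 / θ₁ + 2 / (θ₁ * √θ₁) with hC
  have c1 : 0 ≤ (√θ₁)⁻¹ := by positivity
  have c2 : 0 ≤ 1 / θ₁ := by positivity
  have c3 : 0 ≤ 2 / (θ₁ * √θ₁) := by positivity
  have hC0 : 0 ≤ C := by positivity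
  -- Near `(x₀, t₀)` one has `t₀/2 < t < 3t₀/2`, so `C` controls the prefactors and `16 t < 24 t₀`.
  -- Then `(y - x₀)² ≤ 2 (x - y)² + 2` recentres the Gaussian at `x₀`.
  set bound : ℝ → ℝ := fun y => C * exp (1 / (24 * t₀)) * B * exp (-(1 / (48 * t₀)) * (y - x₀) ^ 2)
  have hbound : Integrable bound :=
    ((integrable_exp_neg_mul_sq (b := 1 / (48 * t₀)) (by positivity)).comp_sub_right x₀).const_mul _
  have H := hasDerivAt_superposition (μ := volume) (ξ := fun y : ℝ => y) (η := fun _ => 0) (β := f)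
    (bound := bound) measurable_id measurable_const hf.measurable (x₀ := x₀) (t₀ := t₀) hρ0 hbound ?_
  · obtain ⟨H1, H2, H3⟩ := H
    have e1 : ∀ x, heatFlow f x t₀ = ∫ y, heatKernel (x - y) (t₀ - 0) * f y :=
      fun x => heatFlow_eq f x ht₀
    refine ⟨?_, ∫ y, heatKernelXX (x₀ - y) (t₀ - 0) * f y, ?_, ?_⟩
    · have := H1 x₀ (Metric.mem_ball_self hρ0)
      simp only [← e1] at this
      simpa using this
    · refine tendsto_symmetric_second_difference (f := fun x => heatFlow f x t₀) ?_ H2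
      filter_upwards [Metric.ball_mem_nhds x₀ hρ0] with x hx
      simpa only [← e1] using H1 x hx
    · refine H3.congr_of_eventuallyEq ?_
      filter_upwards [eventually_gt_nhds ht₀] with t ht
      exact heatFlow_eq f x₀ ht
  · intro y x hx t ht
    rw [Metric.mem_ball, dist_eq] at hx ht
    have ht1 : |t - t₀| < t₀ / 2 := ht.trans_le (min_le_right _ _)
    have hx1 : |x - x₀| < 1 := hx.trans_le (min_le_left _ _)
    rw [abs_lt] at ht1 hx1
    rw [sub_zero]
    have t0 : 0 < t := by linarith
    have htθ : θ₁ ≤ t := by linarith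
    set z := x - y with hz
    have ez : exp (-(z ^ 2 / (16 * t))) ≤
        exp (1 / (24 * t₀)) * exp (-(1 / (48 * t₀)) * (y - x₀) ^ 2) := by
      rw [← exp_add]
      apply exp_le_exp.2
      have a1 : z ^ 2 / (24 * t₀) ≤ z ^ 2 / (16 * t) :=
        div_le_div_of_nonneg_left (sq_nonneg _) (by positivity) (by linarith)
      have a2 : (y - x₀) ^ 2 ≤ 2 * z ^ 2 + 2 := by
        have : y - x₀ = (x - x₀) - z := by rw [hz]; ring
        rw [this]; nlinarith [sq_nonneg (x - x₀ + z)]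
      have a3 : -(z ^ 2 / (24 * t₀)) ≤ 1 / (24 * t₀) + -(1 / (48 * t₀)) * (y - x₀) ^ 2 := by
        have : 1 / (24 * t₀) + -(1 / (48 * t₀)) * (y - x₀) ^ 2 + z ^ 2 / (24 * t₀)
            = (2 * z ^ 2 + 2 - (y - x₀) ^ 2) / (48 * t₀) := by field_simp; ring
        have : 0 ≤ (2 * z ^ 2 + 2 - (y - x₀) ^ 2) / (48 * t₀) := div_nonneg (by linarith) (by positivity)
        linarith
      linarith
    have mono (c : ℝ) (hc : 0 < c) (hc' : c ≤ 16) :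
        exp (-(z ^ 2 / (c * t))) ≤ exp (-(z ^ 2 / (16 * t))) := by
      apply exp_le_exp.2
      have : z ^ 2 / (16 * t) ≤ z ^ 2 / (c * t) := by gcongr
      linarith
    have fin (q : ℝ) (hq : |q| ≤ C * exp (-(z ^ 2 / (16 * t)))) : |q * f y| ≤ bound y := by
      rw [abs_mul]
      calc _ ≤ C * (exp (1 / (24 * t₀)) * exp (-(1 / (48 * t₀)) * (y - x₀) ^ 2)) * B := by
            gcongr
            · exact hq.trans (by gcongr)
            · exact hB y
        _ = _ := by simp only [bound]; ring
    refine ⟨Or.inr t0.ne', fin _ ?_, fin _ ?_, fin _ ?_⟩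
    · rw [abs_of_nonneg (heatKernel_nonneg _ _)]
      unfold heatKernel
      gcongr
      · calc (√(4 * π * t))⁻¹ ≤ (√θ₁)⁻¹ := by
              gcongr
              exact htθ.trans (le_four_pi_mul t0)
          _ ≤ C := by rw [hC]; linarith
      · norm_num
    · refine (abs_heatKernelX_le z t0).trans ?_
      rw [div_eq_mul_one_div, mul_comm]
      gcongr
      calc 1 / t ≤ 1 / θ₁ := by gcongr
        _ ≤ C := by rw [hC]; linarith
    · refine (abs_heatKernelXX_le z t0).trans ?_
      calc 2 * exp (-(z ^ 2 / (8 * t))) / (t * √t) = 2 / (t * √t) * exp (-(z ^ 2 / (8 * t))) := by ring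
        _ ≤ C * exp (-(z ^ 2 / (16 * t))) := by
          gcongr
          · calc 2 / (t * √t) ≤ 2 / (θ₁ * √θ₁) := by gcongr
              _ ≤ C := by rw [hC]; linarith
          · norm_num

/-- The weighted gradient of the heat flow is of order `t^{-1/2}`: the kernel gradient is `1/t`
times a Gaussian of mass of order `√t`. The mean value inequality is applied on the ball of radius
`d` about the point `x` carrying the weight. -/
lemma weight_mul_abs_heatFlow_sub_le {f : ℝ → ℝ} (hf : Continuous f) {α N : ℝ} (hα : 0 ≤ α)
    (hN : ∀ x, exp (α * |x|) * |f x| ≤ N) {t : ℝ} (ht : 0 < t) {x y₁ y₂ d : ℝ}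
    (h₁ : |y₁ - x| ≤ d) (h₂ : |y₂ - x| ≤ d) :
    exp (α * |x|) * |heatFlow f y₁ t - heatFlow f y₂ t| ≤
      exp (α * d) * (exp (2 * α ^ 2 * t) * (4 * √π) / √t * N) * |y₁ - y₂| := by
  have hN0 : 0 ≤ N := le_trans (by positivity) (hN 0)
  have hB : ∀ x, |f x| ≤ N := fun x => le_trans
    (le_mul_of_one_le_left (abs_nonneg _) (one_le_exp (by positivity))) (hN x)
  have hs : 0 < √t := sqrt_pos.2 ht
  have hd (y : ℝ) (hy : |y - x| ≤ d) : ‖∫ w, heatKernelX (y - w) t * f w‖ ≤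
      exp (α * d) * (exp (2 * α ^ 2 * t) * (4 * √π) / √t * N) * exp (-(α * |x|)) := by
    have hi : Integrable fun w : ℝ => exp (-(1 / (16 * t)) * (y - w) ^ 2) :=
      (integrable_exp_neg_mul_sq (b := 1 / (16 * t)) (by positivity)).comp_sub_left y
    have key : ‖∫ w, heatKernelX (y - w) t * f w‖ ≤
        ∫ w : ℝ, exp (α * d) * exp (-(α * |x|)) * (exp (2 * α ^ 2 * t) / t * N) *
          exp (-(1 / (16 * t)) * (y - w) ^ 2) := by
      refine norm_integral_le_of_norm_le (hi.const_mul _) (.of_forall fun w => ?_)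
      have h1 := weight_mul_abs_heatKernelX_le (α := α) (y - w) ht
      have h2 := hN w
      have h3 : |x| ≤ d + |y - w| + |w| := by
        have : x = -(y - x) + (y - w) + w := by ring
        calc |x| = |-(y - x) + (y - w) + w| := by rw [← this]
          _ ≤ |-(y - x)| + |y - w| + |w| := abs_add_three _ _ _
          _ ≤ _ := by rw [abs_neg]; gcongr
      have h4 : 1 ≤ exp (α * d) * exp (-(α * |x|)) * (exp (α * |y - w|) * exp (α * |w|)) := by
        rw [← exp_add, ← exp_add, ← exp_add]
        apply one_le_exp
        have := mul_le_mul_of_nonneg_left h3 hα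
        linarith
      rw [norm_mul, norm_eq_abs, norm_eq_abs]
      calc |heatKernelX (y - w) t| * |f w| ≤
          exp (α * d) * exp (-(α * |x|)) * (exp (α * |y - w|) * exp (α * |w|)) *
            (|heatKernelX (y - w) t| * |f w|) := le_mul_of_one_le_left (by positivity) h4
        _ = exp (α * d) * exp (-(α * |x|)) * ((exp (α * |y - w|) * |heatKernelX (y - w) t|) *
            (exp (α * |w|) * |f w|)) := by ring
        _ ≤ exp (α * d) * exp (-(α * |x|)) *
            ((exp (2 * α ^ 2 * t) * exp (-((y - w) ^ 2 / (16 * t))) / t) * N) := by gcongr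
        _ = _ := by
          rw [show -((y - w) ^ 2 / (16 * t)) = -(1 / (16 * t)) * (y - w) ^ 2 by ring]; ring
    refine key.trans (le_of_eq ?_)
    rw [integral_const_mul,
      integral_sub_left_eq_self (fun w => exp (-(1 / (16 * t)) * w ^ 2)) volume y, integral_gaussian]
    have e : √(π / (1 / (16 * t))) = 4 * √π * √t := by
      rw [show π / (1 / (16 * t)) = 4 ^ 2 * π * t by field_simp; norm_num, sqrt_mul (by positivity),
        sqrt_mul (by norm_num), sqrt_sq (by norm_num)]
    have : t = √t * √t := (mul_self_sqrt ht.le).symm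
    rw [e]
    have e2 : exp (2 * α ^ 2 * t) / t * √t = exp (2 * α ^ 2 * t) / √t := by
      rw [div_mul_eq_mul_div, div_eq_div_iff ht.ne' hs.ne']
      rw [mul_assoc, ← this]
    linear_combination exp (α * d) * exp (-(α * |x|)) * N * 4 * √π * e2
  have hm := Convex.norm_image_sub_le_of_norm_hasDerivWithin_le (f := fun y => heatFlow f y t)
    (f' := fun y => ∫ w, heatKernelX (y - w) t * f w) (s := Metric.closedBall x d)
    (fun y _ => (hasDerivAt_heatFlow hf hB y ht).1.hasDerivWithinAt)
    (fun y hy => hd y (by simpa [dist_eq] using hy)) (convex_closedBall x d)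
    (x := y₂) (y := y₁) (by simpa [dist_eq] using h₂) (by simpa [dist_eq] using h₁)
  rw [norm_eq_abs, norm_eq_abs] at hm
  calc _ ≤ exp (α * |x|) * (exp (α * d) * (exp (2 * α ^ 2 * t) * (4 * √π) / √t * N) *
        exp (-(α * |x|)) * |y₁ - y₂|) := by gcongr
    _ = (exp (α * |x|) * exp (-(α * |x|))) * (exp (α * d) *
        (exp (2 * α ^ 2 * t) * (4 * √π) / √t * N) * |y₁ - y₂|) := by ring
    _ = _ := by rw [← exp_add]; simp

/-! ### Single layer potential: continuity and heat equation off the curve -/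

/-- The single layer heat potential with density `b` on the curve `x = s(t)`. -/
def layerPotential (s b : ℝ → ℝ) (x t : ℝ) : ℝ :=
  ∫ θ in (0 : ℝ)..t, heatKernel (x - s (t - θ)) θ * b (t - θ)

lemma intervalIntegrable_inv_sqrt (a t : ℝ) : IntervalIntegrable (fun θ : ℝ => (√θ)⁻¹) volume a t := by
  have (t : ℝ) : IntervalIntegrable (fun θ : ℝ => (√θ)⁻¹) volume 0 t := by
    rcases le_total 0 t with ht | ht
    · refine (intervalIntegral.intervalIntegrable_rpow' (a := 0) (b := t) (r := -(1 / 2))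
        (by norm_num)).congr ?_
      intro θ hθ
      rw [uIoc_of_le ht] at hθ
      simp only
      rw [rpow_neg hθ.1.le, sqrt_eq_rpow]
    · refine (intervalIntegrable_const (c := (0 : ℝ))).congr ?_
      intro θ hθ
      rw [uIoc_of_ge ht] at hθ
      simp [sqrt_eq_zero_of_nonpos hθ.2]
  exact (this a).symm.trans (this t)

lemma integral_inv_sqrt {t : ℝ} (ht : 0 ≤ t) : ∫ θ in (0 : ℝ)..t, (√θ)⁻¹ = 2 * √t := by
  have h : ∫ θ in (0 : ℝ)..t, (√θ)⁻¹ = ∫ θ in (0 : ℝ)..t, θ ^ (-(1 / 2) : ℝ) := by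
    refine intervalIntegral.integral_congr_ae (.of_forall fun θ hθ => ?_)
    rw [uIoc_of_le ht] at hθ
    rw [rpow_neg hθ.1.le, sqrt_eq_rpow]
  rw [h, integral_rpow (Or.inl (by norm_num)), sqrt_eq_rpow]
  norm_num
  ring

/-- A domain of integration independent of `t` is needed for dominated convergence in `(x, t)` and
for the scaling `θ = r² φ` in the jump relation. -/
lemma layerPotential_eq_indicator (s b : ℝ → ℝ) (x t : ℝ) :
    layerPotential s b x t =
      ∫ θ in Ioi (0 : ℝ), if θ < t then heatKernel (x - s (t - θ)) θ * b (t - θ) else 0 := by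
  unfold layerPotential
  rcases le_total 0 t with ht | ht
  · rw [intervalIntegral.integral_of_le ht, integral_Ioc_eq_integral_Ioo,
      ← integral_indicator measurableSet_Ioo, ← integral_indicator measurableSet_Ioi]
    congr 1
    ext θ
    by_cases h1 : 0 < θ <;> by_cases h2 : θ < t <;> simp [indicator, h1, h2]
  · rw [intervalIntegral.integral_of_ge ht]
    have h1 : ∫ θ in Ioc t 0, heatKernel (x - s (t - θ)) θ * b (t - θ) = 0 := by
      refine setIntegral_eq_zero_of_forall_eq_zero fun θ hθ => ?_
      rw [heatKernel_of_nonpos _ hθ.2, zero_mul]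
    rw [h1, neg_zero]
    refine (setIntegral_eq_zero_of_forall_eq_zero fun θ hθ => ?_).symm
    rw [if_neg]
    have : 0 < θ := hθ
    linarith

lemma measurable_layer_integrand {s b : ℝ → ℝ} (hs : Continuous s) (hb : Continuous b) (x t : ℝ) :
    Measurable fun θ => if θ < t then heatKernel (x - s (t - θ)) θ * b (t - θ) else 0 := by
  refine Measurable.ite measurableSet_Iio ?_ measurable_const
  have h1 : Measurable fun θ => x - s (t - θ) := by fun_prop
  exact (measurable_heatKernel.comp (h1.prodMk measurable_id)).mul (by fun_prop)

lemma abs_layer_integrand_le {s b : ℝ → ℝ} {B : ℝ} (hB : ∀ τ, |b τ| ≤ B) (x t θ : ℝ) :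
    |heatKernel (x - s (t - θ)) θ * b (t - θ)| ≤ B * (√θ)⁻¹ := by
  rw [abs_mul, abs_of_nonneg (heatKernel_nonneg _ _), mul_comm B]
  gcongr
  · exact heatKernel_le _ _
  · exact hB _

lemma integrableOn_layer_integrand {s b : ℝ → ℝ} (hs : Continuous s) (hb : Continuous b) {B : ℝ}
    (hB : ∀ τ, |b τ| ≤ B) (x t : ℝ) :
    IntegrableOn (fun θ => if θ < t then heatKernel (x - s (t - θ)) θ * b (t - θ) else 0)
      (Ioi 0) := by
  have hB0 : 0 ≤ B := (abs_nonneg _).trans (hB 0)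
  have h1 : Integrable (indicator (Ioc 0 t) fun θ : ℝ => B * (√θ)⁻¹) :=
    (integrable_indicator_iff measurableSet_Ioc).2
      (((intervalIntegrable_inv_sqrt 0 t).1).const_mul B)
  refine h1.integrableOn.mono' (measurable_layer_integrand hs hb x t).aestronglyMeasurable ?_
  refine (ae_restrict_mem measurableSet_Ioi).mono fun θ hθ => ?_
  have : 0 < θ := hθ
  split_ifs with h
  · rw [indicator_of_mem (show θ ∈ Ioc 0 t from ⟨this, h.le⟩)]
    exact abs_layer_integrand_le hB x t θ
  · rw [norm_zero]
    exact indicator_nonneg (fun _ _ => by positivity) _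

lemma continuousAt_heatKernel (z : ℝ) {θ : ℝ} (hθ : 0 < θ) :
    ContinuousAt (fun p : ℝ × ℝ => heatKernel p.1 p.2) (z, θ) := by
  unfold heatKernel
  have : √(4 * π * θ) ≠ 0 := (sqrt_pos.2 (by positivity)).ne'
  have h2 : 4 * θ ≠ 0 := by positivity
  refine ContinuousAt.mul (ContinuousAt.inv₀ (by fun_prop) this) ?_
  refine ContinuousAt.rexp (ContinuousAt.neg (ContinuousAt.div (by fun_prop) (by fun_prop) h2))

lemma continuous_layerPotential {s b : ℝ → ℝ} (hs : Continuous s) (hb : Continuous b) {B : ℝ}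
    (hB : ∀ τ, |b τ| ≤ B) : Continuous fun p : ℝ × ℝ => layerPotential s b p.1 p.2 := by
  have hB0 : 0 ≤ B := (abs_nonneg _).trans (hB 0)
  simp only [layerPotential_eq_indicator]
  rw [continuous_iff_continuousAt]
  rintro ⟨x₀, t₀⟩
  have h1 : Integrable (indicator (Ioc 0 (t₀ + 1)) fun θ : ℝ => B * (√θ)⁻¹) :=
    (integrable_indicator_iff measurableSet_Ioc).2
      (((intervalIntegrable_inv_sqrt 0 (t₀ + 1)).1).const_mul B)
  have ev : ∀ᶠ p : ℝ × ℝ in 𝓝 (x₀, t₀), p.2 < t₀ + 1 :=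
    (continuous_snd.tendsto (x₀, t₀)).eventually (gt_mem_nhds (by simp))
  refine continuousAt_of_dominated
    (.of_forall fun p => (measurable_layer_integrand hs hb p.1 p.2).aestronglyMeasurable) ?_
    h1.integrableOn ?_
  · filter_upwards [ev] with p hp
    refine (ae_restrict_mem measurableSet_Ioi).mono fun θ hθ => ?_
    have : 0 < θ := hθ
    split_ifs with h
    · rw [indicator_of_mem (show θ ∈ Ioc 0 (t₀ + 1) from ⟨this, by linarith⟩)]
      exact abs_layer_integrand_le hB _ _ θ
    · rw [norm_zero]
      exact indicator_nonneg (fun _ _ => by positivity) _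
  -- The cutoff is discontinuous only at `θ = t₀`, a null set.
  · have hne : ∀ᵐ θ ∂(volume.restrict (Ioi (0 : ℝ))), θ ≠ t₀ := by
      refine ae_restrict_of_ae ?_
      simp [ae_iff]
    filter_upwards [hne, ae_restrict_mem measurableSet_Ioi] with θ h2 hθ
    rcases lt_or_gt_of_ne h2 with h | h
    · have ev2 : ∀ᶠ p : ℝ × ℝ in 𝓝 (x₀, t₀), θ < p.2 :=
        (continuous_snd.tendsto (x₀, t₀)).eventually (lt_mem_nhds h)
      have : ContinuousAt (fun p : ℝ × ℝ => heatKernel (p.1 - s (p.2 - θ)) θ * b (p.2 - θ))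
          (x₀, t₀) := by
        refine ContinuousAt.mul ?_ (by fun_prop)
        have h3 : Continuous fun p : ℝ × ℝ => (p.1 - s (p.2 - θ), θ) := by fun_prop
        exact ContinuousAt.comp (f := fun p : ℝ × ℝ => (p.1 - s (p.2 - θ), θ))
          (continuousAt_heatKernel _ hθ) h3.continuousAt
      refine this.congr ?_
      filter_upwards [ev2] with p hp
      rw [if_pos hp]
    · have ev2 : ∀ᶠ p : ℝ × ℝ in 𝓝 (x₀, t₀), p.2 < θ :=
        (continuous_snd.tendsto (x₀, t₀)).eventually (gt_mem_nhds h)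
      refine (continuousAt_const (y := (0 : ℝ))).congr ?_
      filter_upwards [ev2] with p hp
      rw [if_neg hp.not_gt]

lemma abs_layerPotential_le {s b : ℝ → ℝ} {B : ℝ} (hB : ∀ τ, |b τ| ≤ B) (x : ℝ) {t : ℝ}
    (ht : 0 ≤ t) : |layerPotential s b x t| ≤ B * (2 * √t) := by
  unfold layerPotential
  rw [← integral_inv_sqrt ht, ← intervalIntegral.integral_const_mul, ← norm_eq_abs]
  refine intervalIntegral.norm_integral_le_of_norm_le ht (.of_forall fun θ _ => ?_)
    ((intervalIntegrable_inv_sqrt 0 t).const_mul B)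
  exact abs_layer_integrand_le hB x t θ

/-- After `τ = t - θ`, causality of the kernel lets the source times run up to any `T ≥ t`, so the
domain no longer moves with `t`. -/
lemma integral_Ioc_eq_of_causal {k : ℝ → ℝ → ℝ} (hk : ∀ z θ, θ ≤ 0 → k z θ = 0) (s b : ℝ → ℝ)
    (x : ℝ) {t T : ℝ} (ht : 0 ≤ t) (htT : t ≤ T) :
    ∫ τ in Ioc 0 T, k (x - s τ) (t - τ) * b τ = ∫ θ in (0 : ℝ)..t, k (x - s (t - θ)) θ * b (t - θ) := by
  have h := intervalIntegral.integral_comp_sub_left (a := 0) (b := t)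
    (fun τ => k (x - s τ) (t - τ) * b τ) t
  simp only [sub_sub_cancel, sub_self, sub_zero] at h
  rw [h, intervalIntegral.integral_of_le ht]
  refine (setIntegral_eq_of_subset_of_forall_sdiff_eq_zero measurableSet_Ioc
    (Ioc_subset_Ioc_right htT) fun τ hτ => ?_)
  have : t < τ := by
    by_contra hc
    exact hτ.2 ⟨hτ.1.1, not_lt.1 hc⟩
  rw [hk _ _ (by linarith), zero_mul]

/-- Off the curve, every source point `(s τ, τ)` stays at distance `ρ` from the nearby points `(x,
t)`, in space or in time. The kernel and its derivatives are then bounded by a constant, which is a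
sufficient majorant on a bounded time interval. -/
lemma hasDerivAt_layerPotential {s b : ℝ → ℝ} (hs : Continuous s) (hb : Continuous b) {B : ℝ}
    (hB : ∀ τ, |b τ| ≤ B) {x₀ t₀ : ℝ} (ht₀ : 0 < t₀) (hx₀ : x₀ ≠ s t₀) :
    HasDerivAt (fun x => layerPotential s b x t₀)
      (∫ θ in (0 : ℝ)..t₀, heatKernelX (x₀ - s (t₀ - θ)) θ * b (t₀ - θ)) x₀ ∧
    CaloricAt (layerPotential s b) x₀ t₀ := by
  have hB0 : 0 ≤ B := (abs_nonneg _).trans (hB 0)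
  set d := |x₀ - s t₀| / 3 with hd
  have hd0 : 0 < d := by have := abs_pos.2 (sub_ne_zero.2 hx₀); positivity
  obtain ⟨ρ₁, hρ₁, hρs⟩ := Metric.continuousAt_iff.1 (hs.continuousAt (x := t₀)) d hd0
  set ρ := min (min (ρ₁ / 2) d) (min t₀ 1) with hρ
  have hρ0 : 0 < ρ := lt_min (lt_min (by positivity) hd0) (lt_min ht₀ one_pos)
  have r1 : ρ ≤ ρ₁ / 2 := (min_le_left _ _).trans (min_le_left _ _)
  have r2 : ρ ≤ d := (min_le_left _ _).trans (min_le_right _ _)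
  have r3 : ρ ≤ t₀ := (min_le_right _ _).trans (min_le_left _ _)
  have r4 : ρ ≤ 1 := (min_le_right _ _).trans (min_le_right _ _)
  obtain ⟨C, hC⟩ := exists_bound_away_from_origin hρ0
  have hC0 : 0 ≤ C := (abs_nonneg _).trans (hC ρ 0 (Or.inl (le_abs_self ρ))).1
  have H := hasDerivAt_superposition (μ := volume.restrict (Ioc 0 (t₀ + 1))) (ξ := s)
    (η := fun τ : ℝ => τ) (β := b) (bound := fun _ => C * B) hs.measurable measurable_id
    hb.measurable (x₀ := x₀) (t₀ := t₀) hρ0 (integrable_const _) ?_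
  · obtain ⟨H1, H2, H3⟩ := H
    have e1 : ∀ x, layerPotential s b x t₀ =
        ∫ τ in Ioc 0 (t₀ + 1), heatKernel (x - s τ) (t₀ - τ) * b τ := fun x =>
      (integral_Ioc_eq_of_causal (fun z θ h => heatKernel_of_nonpos z h) s b x ht₀.le
        (by linarith)).symm
    refine ⟨?_, ∫ τ in Ioc 0 (t₀ + 1), heatKernelXX (x₀ - s τ) (t₀ - τ) * b τ, ?_, ?_⟩
    · have := H1 x₀ (Metric.mem_ball_self hρ0)
      simp only [← e1] at this
      rwa [integral_Ioc_eq_of_causal (fun z θ h => heatKernelX_of_nonpos z h) s b x₀ ht₀.le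
        (by linarith)] at this
    · refine tendsto_symmetric_second_difference (f := fun x => layerPotential s b x t₀) ?_ H2
      filter_upwards [Metric.ball_mem_nhds x₀ hρ0] with x hx
      simpa only [← e1] using H1 x hx
    · refine H3.congr_of_eventuallyEq ?_
      filter_upwards [eventually_gt_nhds ht₀, eventually_lt_nhds (lt_add_one t₀)] with t ht ht'
      exact (integral_Ioc_eq_of_causal (fun z θ h => heatKernel_of_nonpos z h) s b x₀ ht.le
        ht'.le).symm
  · intro τ x hx t ht
    rw [Metric.mem_ball, dist_eq] at hx ht
    have far : ρ ≤ |x - s τ| ∨ ρ ≤ |t - τ| := by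
      by_contra! hc
      have h1 : dist τ t₀ < ρ₁ := by
        rw [dist_eq]
        calc |τ - t₀| = |-(t - τ) + (t - t₀)| := by ring_nf
          _ ≤ |-(t - τ)| + |t - t₀| := abs_add_le _ _
          _ < _ := by rw [abs_neg]; linarith [hc.2]
      have h2 := hρs h1
      rw [dist_eq] at h2
      have h3 : |x₀ - s t₀| ≤ |-(x - x₀)| + |x - s τ| + |s τ - s t₀| := by
        have : x₀ - s t₀ = -(x - x₀) + (x - s τ) + (s τ - s t₀) := by ring
        rw [this]; exact abs_add_three _ _ _
      rw [abs_neg] at h3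
      linarith [hc.1]
    have bnd (q : ℝ) (hq : |q| ≤ C) : |q * b τ| ≤ C * B := by
      rw [abs_mul]; gcongr; exact hB τ
    obtain ⟨c0, c1, c2⟩ := hC _ _ far
    refine ⟨?_, bnd _ c0, bnd _ c1, bnd _ c2⟩
    rcases far with h | h
    · exact Or.inl (abs_pos.1 (hρ0.trans_le h))
    · exact Or.inr (abs_pos.1 (hρ0.trans_le h))

/-! ### Jump relation for the single layer potential -/

lemma tendsto_integral_exp_neg_sq_div_four :
    Tendsto (fun y => ∫ u in (0 : ℝ)..y, exp (-(1 / 4) * u ^ 2)) atTop (𝓝 √π) := by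
  have h := intervalIntegral_tendsto_integral_Ioi (f := fun u : ℝ => exp (-(1 / 4) * u ^ 2)) 0
    (integrable_exp_neg_mul_sq (by norm_num)).integrableOn tendsto_id
  rw [integral_gaussian_Ioi, show π / (1 / 4) = 2 ^ 2 * π by ring, sqrt_mul (by norm_num),
    sqrt_sq zero_le_two, mul_div_cancel_left₀ _ two_ne_zero] at h
  exact h

/-- Integrating by parts in `φ` gives the explicit antiderivative `F₀`, with the Gaussian integral
`E` evaluated at `1/√φ`. It tends to `0` at infinity and to `-1/2` at `0⁺`, whence the value
assigned to `F` on `φ ≤ 0`. -/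
lemma integral_heatKernel_zero_sub_one :
    ∫ φ in Ioi (0 : ℝ), (heatKernel 0 φ - heatKernel 1 φ) = 1 / 2 := by
  have hsp : 0 < √π := sqrt_pos.2 pi_pos
  set E : ℝ → ℝ := fun y => ∫ u in (0 : ℝ)..y, exp (-(1 / 4) * u ^ 2) with hE
  have dE (y : ℝ) : HasDerivAt E (exp (-(1 / 4) * y ^ 2)) y :=
    intervalIntegral.integral_hasDerivAt_right
      (Continuous.intervalIntegrable (by fun_prop) _ _)
      (Continuous.stronglyMeasurableAtFilter (by fun_prop) _ _)
      (Continuous.continuousAt (by fun_prop))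
  set F₀ : ℝ → ℝ := fun φ => (2 * √π)⁻¹ * (2 * √φ * (1 - exp (-(1 / (4 * φ)))) - E (√φ)⁻¹) with hF₀
  set F : ℝ → ℝ := fun φ => if φ ≤ 0 then -(1 / 2) else F₀ φ with hF
  have small : ∀ φ : ℝ, 0 < φ → 0 ≤ 1 - exp (-(1 / (4 * φ))) ∧ 1 - exp (-(1 / (4 * φ))) ≤ 1 ∧
      1 - exp (-(1 / (4 * φ))) ≤ 1 / (4 * φ) := by
    intro φ hφ
    have h1 : 0 ≤ 1 / (4 * φ) := by positivity
    refine ⟨?_, ?_, ?_⟩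
    · have : exp (-(1 / (4 * φ))) ≤ 1 := exp_le_one_iff.2 (by linarith)
      linarith
    · have := exp_pos (-(1 / (4 * φ)))
      linarith
    · have := add_one_le_exp (-(1 / (4 * φ)))
      linarith
  have hd : ∀ φ ∈ Ioi (0 : ℝ), HasDerivAt F (heatKernel 0 φ - heatKernel 1 φ) φ := by
    intro φ hφ
    have hφ0 : 0 < φ := hφ
    have hs : 0 < √φ := sqrt_pos.2 hφ0
    have hs2 : √φ ^ 2 = φ := sq_sqrt hφ0.le
    have h1 : HasDerivAt (fun φ : ℝ => √φ) (1 / (2 * √φ)) φ := hasDerivAt_sqrt hφ0.ne'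
    have h2 : HasDerivAt (fun φ : ℝ => exp (-(1 / (4 * φ))))
        (exp (-(1 / (4 * φ))) * (1 / (4 * φ ^ 2))) φ := by
      apply HasDerivAt.exp
      have := (((hasDerivAt_id φ).const_mul 4).inv (by positivity : 4 * id φ ≠ 0)).neg
      simp only [id, ← one_div] at this
      refine this.congr_deriv ?_
      field_simp
    have h3 : HasDerivAt (fun φ => E (√φ)⁻¹)
        (exp (-(1 / 4) * (√φ)⁻¹ ^ 2) * (-(1 / (2 * √φ)) / √φ ^ 2)) φ :=
      (dE _).comp φ (h1.inv hs.ne')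
    have h4 : HasDerivAt F₀ (heatKernel 0 φ - heatKernel 1 φ) φ := by
      refine (((((h1.const_mul 2).mul (h2.const_sub 1))).sub h3).const_mul (2 * √π)⁻¹).congr_deriv ?_
      unfold heatKernel
      have e1 : exp (-(1 / 4) * (√φ)⁻¹ ^ 2) = exp (-(1 / (4 * φ))) := by
        rw [inv_pow, hs2]; congr 1; field_simp
      have e2 : √(4 * π * φ) = 2 * √π * √φ := by
        rw [show 4 * π * φ = 2 ^ 2 * π * φ by ring, sqrt_mul (by positivity),
          sqrt_mul (by norm_num), sqrt_sq zero_le_two]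
      rw [e1, e2]
      have e3 : φ = √φ ^ 2 := hs2.symm
      generalize √φ = q at *
      subst e3
      simp
      field_simp
      ring
    refine h4.congr_of_eventuallyEq ?_
    filter_upwards [eventually_gt_nhds hφ0] with y hy
    simp [hF, not_le.2 hy]
  have hnn : ∀ φ ∈ Ioi (0 : ℝ), 0 ≤ heatKernel 0 φ - heatKernel 1 φ := by
    intro φ hφ
    have hφ0 : 0 < φ := hφ
    unfold heatKernel
    rw [← mul_sub]
    have : 0 ≤ (√(4 * π * φ))⁻¹ := by positivity
    apply mul_nonneg this
    simpa using hφ0.le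
  have sq0 : Tendsto (fun φ : ℝ => √φ) (𝓝[>] 0) (𝓝[>] 0) := by
    refine tendsto_nhdsWithin_iff.2 ⟨?_, ?_⟩
    · have := continuous_sqrt.continuousWithinAt (s := Ioi 0) (x := 0) |>.tendsto
      simpa using this
    · filter_upwards [self_mem_nhdsWithin] with φ hφ
      exact sqrt_pos.2 hφ
  have hc : ContinuousWithinAt F (Ici 0) 0 := by
    rw [← continuousWithinAt_Ioi_iff_Ici]
    have hF0 : F 0 = -(1 / 2) := by simp [hF]
    unfold ContinuousWithinAt
    rw [hF0]
    have t1 : Tendsto (fun φ : ℝ => E (√φ)⁻¹) (𝓝[>] 0) (𝓝 √π) :=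
      tendsto_integral_exp_neg_sq_div_four.comp (tendsto_inv_nhdsGT_zero.comp sq0)
    have t2 : Tendsto (fun φ : ℝ => 2 * √φ * (1 - exp (-(1 / (4 * φ))))) (𝓝[>] 0) (𝓝 0) := by
      have u : Tendsto (fun φ : ℝ => 2 * √φ) (𝓝[>] 0) (𝓝 0) := by
        simpa using (sq0.mono_right nhdsWithin_le_nhds).const_mul 2
      refine squeeze_zero' ?_ ?_ u
      · filter_upwards [self_mem_nhdsWithin] with φ hφ
        have := (small φ hφ).1
        positivity
      · filter_upwards [self_mem_nhdsWithin] with φ hφ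
        exact mul_le_of_le_one_right (by positivity) (small φ hφ).2.1
    have t3 := (t2.sub t1).const_mul (2 * √π)⁻¹
    have e : (2 * √π)⁻¹ * (0 - √π) = -(1 / 2) := by field_simp; simp
    rw [e] at t3
    refine t3.congr' ?_
    filter_upwards [self_mem_nhdsWithin] with φ hφ
    have : 0 < φ := hφ
    simp [hF, hF₀, not_le.2 this]
  have ht : Tendsto F atTop (𝓝 0) := by
    have sqT : Tendsto (fun φ : ℝ => (√φ)⁻¹) atTop (𝓝 0) :=
      tendsto_inv_atTop_zero.comp tendsto_sqrt_atTop
    have t1 : Tendsto (fun φ : ℝ => E (√φ)⁻¹) atTop (𝓝 0) := by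
      have := ((dE 0).continuousAt.tendsto).comp sqT
      rwa [show E 0 = 0 by simp [hE]] at this
    have t2 : Tendsto (fun φ : ℝ => 2 * √φ * (1 - exp (-(1 / (4 * φ))))) atTop (𝓝 0) := by
      refine squeeze_zero' ?_ ?_ sqT
      · filter_upwards [eventually_gt_atTop 0] with φ hφ
        have := (small φ hφ).1
        positivity
      · filter_upwards [eventually_gt_atTop 0] with φ hφ
        have hs : 0 < √φ := sqrt_pos.2 hφ
        calc _ ≤ 2 * √φ * (1 / (4 * φ)) := by
              gcongr
              exact (small φ hφ).2.2
          _ = 1 / 2 * (√φ)⁻¹ := by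
            have : φ = √φ ^ 2 := (sq_sqrt hφ.le).symm
            generalize √φ = q at *
            subst this
            field_simp; norm_num
          _ ≤ _ := by have : 0 ≤ (√φ)⁻¹ := by positivity
                      linarith
    have t3 := (t2.sub t1).const_mul (2 * √π)⁻¹
    simp only [sub_zero, mul_zero] at t3
    refine t3.congr' ?_
    filter_upwards [eventually_gt_atTop 0] with φ hφ
    simp [hF, hF₀, not_le.2 hφ]
  rw [integral_Ioi_of_hasDerivAt_of_nonneg hc hd hnn ht]
  simp [hF]

lemma heatKernel_neg (z θ : ℝ) : heatKernel (-z) θ = heatKernel z θ := by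
  simp [heatKernel]

lemma heatKernel_scale {r : ℝ} (hr : 0 < r) (z θ : ℝ) :
    r * heatKernel (r * z) (r ^ 2 * θ) = heatKernel z θ := by
  unfold heatKernel
  rw [show 4 * π * (r ^ 2 * θ) = r ^ 2 * (4 * π * θ) by ring, sqrt_mul (by positivity), sqrt_sq hr.le,
    show (r * z) ^ 2 / (4 * (r ^ 2 * θ)) = (r ^ 2 * z ^ 2) / (r ^ 2 * (4 * θ)) by ring,
    mul_div_mul_left _ _ (by positivity : r ^ 2 ≠ 0), mul_inv, ← mul_assoc, ← mul_assoc,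
    mul_inv_cancel₀ hr.ne', one_mul]

/-- A second difference of step one is bounded by the supremum of the second derivative. The decay
`θ^{-3/2}` is integrable at infinity, whereas the `θ^{-1/2}` of the kernel itself is not. -/
lemma abs_symmetric_difference_heatKernel_le (z : ℝ) {θ : ℝ} (hθ : 0 < θ) :
    |heatKernel (1 + z) θ + heatKernel (-1 + z) θ - 2 * heatKernel z θ| ≤ 2 / (θ * √θ) := by
  have b2 (z : ℝ) : ‖heatKernelXX z θ‖ ≤ 2 / (θ * √θ) := by
    refine (abs_heatKernelXX_le z hθ).trans ?_
    gcongr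
    have : exp (-(z ^ 2 / (8 * θ))) ≤ 1 := by
      apply exp_le_one_iff.2
      have : 0 ≤ z ^ 2 / (8 * θ) := by positivity
      linarith
    linarith
  have b1 (y : ℝ) : ‖heatKernelX (y + 1) θ - heatKernelX y θ‖ ≤ 2 / (θ * √θ) := by
    have := Convex.norm_image_sub_le_of_norm_hasDerivWithin_le (s := univ)
      (f := fun z => heatKernelX z θ) (f' := fun z => heatKernelXX z θ)
      (fun z _ => (hasDerivAt_heatKernelX_space z θ).hasDerivWithinAt) (fun z _ => b2 z) convex_univ
      (mem_univ y) (mem_univ (y + 1))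
    simpa using this
  have := Convex.norm_image_sub_le_of_norm_hasDerivWithin_le (s := univ)
    (f := fun y => heatKernel (y + 1) θ - heatKernel y θ)
    (f' := fun y => heatKernelX (y + 1) θ - heatKernelX y θ)
    (fun y _ => (((hasDerivAt_heatKernel_space (y + 1) θ).comp_add_const y 1).sub
      (hasDerivAt_heatKernel_space y θ)).hasDerivWithinAt) (fun y _ => b1 y) convex_univ
    (mem_univ (z - 1)) (mem_univ z)
  simp only [sub_add_cancel, sub_sub_cancel, norm_one, mul_one, norm_eq_abs] at this
  convert this using 2
  rw [show 1 + z = z + 1 by ring, show -1 + z = z - 1 by ring]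
  ring

/-- Under `θ = r² φ` the difference quotient becomes an integral over `φ` of second differences of
step one. The curve enters through `(s t - s (t - r² φ)) / r`, which is `O(r)` for a Lipschitz
curve, so in the limit the curve is straight and the density frozen. The majorant is of order
`φ^{-1/2}` up to `φ = 1` and `φ^{-3/2}` beyond. -/
lemma tendsto_symmetric_difference_layerPotential {s b : ℝ → ℝ} (hb : Continuous b) {B V : ℝ}
    (hB : ∀ τ, |b τ| ≤ B) (hs : ∀ τ τ', |s τ - s τ'| ≤ V * |τ - τ'|) {t : ℝ} (ht : 0 < t) :
    Tendsto (fun r => (layerPotential s b (s t + r) t + layerPotential s b (s t - r) t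
      - 2 * layerPotential s b (s t) t) / r) (𝓝[>] 0) (𝓝 (-b t)) := by
  have hB0 : 0 ≤ B := (abs_nonneg _).trans (hB 0)
  have hV0 : 0 ≤ V := by
    have := (abs_nonneg _).trans (hs 1 0)
    simpa using this
  have hsc : Continuous s := by
    refine LipschitzWith.continuous (K := ⟨V, hV0⟩) (LipschitzWith.of_dist_le_mul fun x y => ?_)
    exact hs x y
  set S : ℝ → ℝ → ℝ := fun r φ => if r ^ 2 * φ < t then
    (heatKernel (1 + (s t - s (t - r ^ 2 * φ)) / r) φ +
      heatKernel (-1 + (s t - s (t - r ^ 2 * φ)) / r) φ -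
      2 * heatKernel ((s t - s (t - r ^ 2 * φ)) / r) φ) * b (t - r ^ 2 * φ) else 0 with hS
  have key : ∀ r : ℝ, 0 < r → (layerPotential s b (s t + r) t + layerPotential s b (s t - r) t
      - 2 * layerPotential s b (s t) t) / r = ∫ φ in Ioi (0 : ℝ), S r φ := by
    intro r hr
    have I (x : ℝ) := integrableOn_layer_integrand hsc hb hB x t
    have I2 : IntegrableOn (fun θ =>
        (if θ < t then heatKernel (s t + r - s (t - θ)) θ * b (t - θ) else 0) +
        (if θ < t then heatKernel (s t - r - s (t - θ)) θ * b (t - θ) else 0)) (Ioi 0) :=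
      (I _).add (I _)
    rw [layerPotential_eq_indicator, layerPotential_eq_indicator, layerPotential_eq_indicator,
      ← integral_const_mul, ← integral_add (I _) (I _), ← integral_sub I2 ((I _).const_mul 2),
      div_eq_iff hr.ne']
    have hr2 : 0 < r ^ 2 := by positivity
    have sc := integral_comp_mul_left_Ioi (fun θ =>
      (if θ < t then heatKernel (s t + r - s (t - θ)) θ * b (t - θ) else 0) +
      (if θ < t then heatKernel (s t - r - s (t - θ)) θ * b (t - θ) else 0) -
      2 * (if θ < t then heatKernel (s t - s (t - θ)) θ * b (t - θ) else 0)) 0 hr2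
    rw [mul_zero, smul_eq_mul, eq_comm, inv_mul_eq_iff_eq_mul₀ hr2.ne'] at sc
    rw [sc, ← integral_const_mul, ← integral_mul_const]
    refine integral_congr_ae (.of_forall fun φ => ?_)
    simp only [hS]
    split_ifs with h
    · have a1 := heatKernel_scale hr (1 + (s t - s (t - r ^ 2 * φ)) / r) φ
      have a2 := heatKernel_scale hr (-1 + (s t - s (t - r ^ 2 * φ)) / r) φ
      have a3 := heatKernel_scale hr ((s t - s (t - r ^ 2 * φ)) / r) φ
      rw [mul_add, mul_div_cancel₀ _ hr.ne'] at a1 a2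
      rw [mul_div_cancel₀ _ hr.ne'] at a3
      rw [← a1, ← a2, ← a3]
      rw [show s t + r - s (t - r ^ 2 * φ) = r * 1 + (s t - s (t - r ^ 2 * φ)) by ring,
        show s t - r - s (t - r ^ 2 * φ) = r * (-1) + (s t - s (t - r ^ 2 * φ)) by ring]
      ring
    · simp
  have lim : ∫ φ in Ioi (0 : ℝ), (heatKernel 1 φ + heatKernel (-1) φ - 2 * heatKernel 0 φ) * b t
      = -b t := by
    have : ∀ φ, (heatKernel 1 φ + heatKernel (-1) φ - 2 * heatKernel 0 φ) * b t =
        (heatKernel 0 φ - heatKernel 1 φ) * (-2 * b t) := by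
      intro φ; rw [heatKernel_neg]; ring
    simp only [this]
    rw [integral_mul_const, integral_heatKernel_zero_sub_one]
    ring
  rw [← lim]
  refine Tendsto.congr' (f₁ := fun r => ∫ φ in Ioi (0 : ℝ), S r φ) ?_ ?_
  · filter_upwards [self_mem_nhdsWithin] with r hr
    exact (key r hr).symm
  set bound : ℝ → ℝ := fun φ => indicator (Ioc 0 1) (fun φ => 4 * B * (√φ)⁻¹) φ +
    indicator (Ioi 1) (fun φ => 2 * B * φ ^ (-(3 / 2) : ℝ)) φ with hbound
  have hbi : Integrable bound := by
    refine Integrable.add ?_ ?_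
    · exact (integrable_indicator_iff measurableSet_Ioc).2
        (((intervalIntegrable_inv_sqrt 0 1).1).const_mul _)
    · exact (integrable_indicator_iff measurableSet_Ioi).2
        ((integrableOn_Ioi_rpow_of_lt (by norm_num) one_pos).const_mul _)
  refine tendsto_integral_filter_of_dominated_convergence bound ?_ ?_ hbi.integrableOn ?_
  · refine .of_forall fun r => Measurable.aestronglyMeasurable ?_
    refine Measurable.ite (measurableSet_lt (by fun_prop) measurable_const) ?_ measurable_const
    have m (c : ℝ) : Measurable fun φ => heatKernel (c + (s t - s (t - r ^ 2 * φ)) / r) φ := by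
      have : Measurable fun φ => (c + (s t - s (t - r ^ 2 * φ)) / r, φ) := by fun_prop
      exact measurable_heatKernel.comp this
    have m0 := m 0
    simp only [zero_add] at m0
    exact (((m 1).add (m (-1))).sub (m0.const_mul 2)).mul (by fun_prop)
  · refine .of_forall fun r => (ae_restrict_mem measurableSet_Ioi).mono fun φ hφ => ?_
    have hφ0 : 0 < φ := hφ
    have hb0 : 0 ≤ bound φ := by
      refine add_nonneg (indicator_nonneg (fun _ _ => by positivity) _)
        (indicator_nonneg (fun y hy => ?_) _)
      have : (0 : ℝ) < y := one_pos.trans hy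
      positivity
    simp only [hS]
    split_ifs with h
    · set z := (s t - s (t - r ^ 2 * φ)) / r
      rw [norm_mul, norm_eq_abs, norm_eq_abs]
      rcases le_or_gt φ 1 with h1 | h1
      · have : bound φ = 4 * (√φ)⁻¹ * B := by
          simp only [hbound]
          rw [indicator_of_mem (show φ ∈ Ioc (0 : ℝ) 1 from ⟨hφ0, h1⟩),
            indicator_of_notMem (by simpa using h1)]
          ring
        rw [this]
        gcongr
        · have a1 := heatKernel_le (1 + z) φ
          have a2 := heatKernel_le (-1 + z) φ
          have a3 := heatKernel_le z φ
          have c1 := heatKernel_nonneg (1 + z) φ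
          have c2 := heatKernel_nonneg (-1 + z) φ
          have c3 := heatKernel_nonneg z φ
          rw [abs_le]; constructor <;> linarith
        · exact hB _
      · have : bound φ = 2 / (φ * √φ) * B := by
          simp only [hbound]
          rw [indicator_of_notMem (fun h => by linarith [h.2]),
            indicator_of_mem (show φ ∈ Ioi (1 : ℝ) from h1)]
          have : φ ^ (-(3 / 2) : ℝ) = 1 / (φ * √φ) := by
            rw [rpow_neg hφ0.le, show (3 / 2 : ℝ) = 1 + 1 / 2 by norm_num, rpow_add hφ0, rpow_one,
              ← sqrt_eq_rpow, one_div]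
          rw [this]; ring
        rw [this]
        gcongr
        · exact abs_symmetric_difference_heatKernel_le z hφ0
        · exact hB _
    · rw [norm_zero]; exact hb0
  · refine (ae_restrict_mem measurableSet_Ioi).mono fun φ hφ => ?_
    have hφ0 : 0 < φ := hφ
    have hr0 : Tendsto (fun r : ℝ => r ^ 2 * φ) (𝓝[>] 0) (𝓝 0) := by
      have : Continuous fun r : ℝ => r ^ 2 * φ := by fun_prop
      simpa using this.continuousWithinAt (s := Ioi 0) (x := 0) |>.tendsto
    have hz : Tendsto (fun r : ℝ => (s t - s (t - r ^ 2 * φ)) / r) (𝓝[>] 0) (𝓝 0) := by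
      have u : Tendsto (fun r : ℝ => V * φ * r) (𝓝[>] 0) (𝓝 0) := by
        have : Continuous fun r : ℝ => V * φ * r := by fun_prop
        simpa using this.continuousWithinAt (s := Ioi 0) (x := 0) |>.tendsto
      refine squeeze_zero_norm' ?_ u
      filter_upwards [self_mem_nhdsWithin] with r hr
      have hr' : 0 < r := hr
      rw [norm_eq_abs, abs_div, abs_of_pos hr', div_le_iff₀ hr']
      have := hs t (t - r ^ 2 * φ)
      rw [sub_sub_cancel, abs_of_nonneg (by positivity : 0 ≤ r ^ 2 * φ)] at this
      linarith
    have hG (c : ℝ) : Tendsto (fun r : ℝ => heatKernel (c + (s t - s (t - r ^ 2 * φ)) / r) φ)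
        (𝓝[>] 0) (𝓝 (heatKernel c φ)) := by
      have h1 := (hasDerivAt_heatKernel_space c φ).continuousAt.tendsto
      have h2 := hz.const_add c
      rw [add_zero] at h2
      exact h1.comp h2
    have hG0 := hG 0
    simp only [zero_add] at hG0
    have hbt : Tendsto (fun r : ℝ => b (t - r ^ 2 * φ)) (𝓝[>] 0) (𝓝 (b t)) := by
      have h2 := hr0.const_sub t
      rw [sub_zero] at h2
      exact (hb.tendsto t).comp h2
    refine Tendsto.congr' ?_ ((((hG 1).add (hG (-1))).sub (hG0.const_mul 2)).mul hbt)
    filter_upwards [hr0.eventually (gt_mem_nhds ht)] with r hr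
    simp only [hS]
    rw [if_pos hr]

/-! ### Maximum principle and representation of solutions -/

/-- If `D` were positive somewhere, `D - ε Q` would have a positive maximum at a positive time for a
suitable barrier `Q`. On the curve this contradicts the absence of a gradient jump, because `Q` has
a concave kink there; off the curve it contradicts the heat equation, because `Q_t` exceeds `Q_xx`.
-/
lemma nonpos_of_caloric_off_curve {D : ℝ → ℝ → ℝ} {s : ℝ → ℝ} {T V B : ℝ}
    (hs : ∀ τ τ', |s τ - s τ'| ≤ V * |τ - τ'|)
    (hc : ContinuousOn (fun p : ℝ × ℝ => D p.1 p.2) (univ ×ˢ Icc 0 T))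
    (hB : ∀ x, ∀ t ∈ Icc 0 T, D x t ≤ B) (h0 : ∀ x, D x 0 ≤ 0)
    (hoff : ∀ x, ∀ t ∈ Ioc 0 T, x ≠ s t → CaloricAt D x t)
    (hon : ∀ t ∈ Ioc 0 T,
      Tendsto (fun r => (D (s t + r) t + D (s t - r) t - 2 * D (s t) t) / r) (𝓝[>] 0) (𝓝 0)) :
    ∀ x, ∀ t ∈ Icc 0 T, D x t ≤ 0 := by
  by_contra! hcon
  obtain ⟨x₁, t₁, ht₁, hpos⟩ := hcon
  have hV0 : 0 ≤ V := by simpa using (abs_nonneg _).trans (hs 1 0)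
  have hsc : Continuous s := by
    refine LipschitzWith.continuous (K := ⟨V, hV0⟩) (LipschitzWith.of_dist_le_mul fun x y => ?_)
    exact hs x y
  have hB0 : 0 < B := hpos.trans_le (hB _ _ ht₁)
  obtain ⟨C, hC⟩ := isCompact_Icc.exists_bound_of_continuousOn (s := Icc 0 T) hsc.continuousOn
  -- The term `x²` confines the maximum, `-|x - s t|` makes the kink, and `C + 1` keeps `Q`
  -- positive. Since `-|x - s t|` may decrease in time at rate at most `V`, the slope `V + 3` leaves
  -- growth at least `3`, against `Q_xx = 2`.
  set Q : ℝ → ℝ → ℝ := fun x t => x ^ 2 - |x - s t| + (C + 1) + (V + 3) * t with hQ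
  have Qlow : ∀ x, ∀ t ∈ Icc 0 T, x ^ 2 / 2 + 1 / 2 ≤ Q x t := by
    intro x t ht
    have a1 : |x - s t| ≤ |x| + C := (abs_sub _ _).trans (by gcongr; exact hC t ht)
    have a2 : 0 ≤ (V + 3) * t := mul_nonneg (by linarith) ht.1
    have a3 := sq_nonneg (|x| - 1)
    have a4 := sq_abs x
    simp only [hQ]
    nlinarith
  have Qcont : Continuous fun p : ℝ × ℝ => Q p.1 p.2 := by simp only [hQ]; fun_prop
  have Q1 : 0 < Q x₁ t₁ := lt_of_lt_of_le (by positivity) (Qlow x₁ t₁ ht₁)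
  set ε := D x₁ t₁ / (2 * Q x₁ t₁) with hε
  have hε0 : 0 < ε := by positivity
  set φ : ℝ → ℝ → ℝ := fun x t => D x t - ε * Q x t with hφ
  have φ1 : 0 < φ x₁ t₁ := by
    have : ε * Q x₁ t₁ = D x₁ t₁ / 2 := by rw [hε]; field_simp
    simp only [hφ]; linarith
  -- For `|x| > N` one has `ε Q ≥ ε x²/2 ≥ B`, so the maximum over the compact box is global.
  set N := |x₁| + 2 * B / ε + 1 with hN
  have hN1 : 1 ≤ N := by rw [hN]; have : 0 ≤ |x₁| + 2 * B / ε := by positivity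
                         linarith
  have hN2 : 2 * B / ε ≤ N := by rw [hN]; linarith [abs_nonneg x₁]
  have hN3 : |x₁| ≤ N := by rw [hN]; have : 0 ≤ 2 * B / ε := by positivity
                            linarith
  have hmem : (x₁, t₁) ∈ Icc (-N) N ×ˢ Icc 0 T := ⟨abs_le.1 hN3, ht₁⟩
  obtain ⟨⟨x₀, t₀⟩, hm, hmax⟩ := (isCompact_Icc.prod isCompact_Icc).exists_isMaxOn ⟨_, hmem⟩
    ((hc.mono (prod_mono (subset_univ _) subset_rfl)).sub
      ((Qcont.const_mul ε).continuousOn (s := Icc (-N) N ×ˢ Icc 0 T)))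
  have ht₀ : t₀ ∈ Icc 0 T := hm.2
  have hφ0 : 0 < φ x₀ t₀ := φ1.trans_le (hmax hmem)
  have hglob : ∀ x, ∀ t ∈ Icc 0 T, φ x t ≤ φ x₀ t₀ := by
    intro x t ht
    by_cases hx : |x| ≤ N
    · exact hmax (show (x, t) ∈ _ from ⟨abs_le.1 hx, ht⟩)
    · have h1 : N ≤ |x| := (not_le.1 hx).le
      have h2 : N ≤ x ^ 2 := by rw [← sq_abs]; nlinarith
      have h3 : 2 * B ≤ N * ε := (div_le_iff₀ hε0).1 hN2
      have h4 := mul_le_mul_of_nonneg_left (Qlow x t ht) hε0.le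
      have h5 := hB x t ht
      have h6 := mul_le_mul_of_nonneg_left h2 hε0.le
      refine le_trans ?_ hφ0.le
      simp only [hφ]
      nlinarith
  have ht₀0 : 0 < t₀ := by
    rcases ht₀.1.eq_or_lt with h | h
    · exfalso
      subst h
      have a1 := Qlow x₀ 0 ht₀
      have a2 : 0 < Q x₀ 0 := lt_of_lt_of_le (by positivity) a1
      have a3 := h0 x₀
      have a4 := mul_pos hε0 a2
      simp only [hφ] at hφ0
      linarith
    · exact h
  have htI : t₀ ∈ Ioc 0 T := ⟨ht₀0, ht₀.2⟩
  have sym : ∀ r, D (x₀ + r) t₀ + D (x₀ - r) t₀ - 2 * D x₀ t₀ ≤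
      ε * (Q (x₀ + r) t₀ + Q (x₀ - r) t₀ - 2 * Q x₀ t₀) := by
    intro r
    have a1 := hglob (x₀ + r) t₀ ht₀
    have a2 := hglob (x₀ - r) t₀ ht₀
    simp only [hφ] at a1 a2
    linarith
  by_cases hx : x₀ = s t₀
  · have lim := hon t₀ htI
    rw [← hx] at lim
    have lim2 : Tendsto (fun r : ℝ => ε * (2 * r - 2)) (𝓝[>] 0) (𝓝 (ε * (2 * 0 - 2))) := by
      have : Continuous fun r : ℝ => ε * (2 * r - 2) := by fun_prop
      exact this.continuousWithinAt.tendsto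
    have := le_of_tendsto_of_tendsto lim lim2 (by
      filter_upwards [self_mem_nhdsWithin] with r hr
      have hr0 : 0 < r := hr
      rw [div_le_iff₀ hr0]
      refine (sym r).trans (le_of_eq ?_)
      simp only [hQ, ← hx, add_sub_cancel_left, sub_self, abs_zero]
      rw [show x₀ - r - x₀ = -r by ring, abs_neg, abs_of_pos hr0]
      ring)
    linarith
  · obtain ⟨d, lim, hd⟩ := hoff x₀ t₀ htI hx
    have hr₀ : 0 < |x₀ - s t₀| := abs_pos.2 (sub_ne_zero.2 hx)
    -- For `r < |x₀ - s t₀|` the points `x₀ ± r` lie on the same side of the curve, where `|x - s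
    -- t₀|` is affine.
    have d1 : d ≤ 2 * ε := by
      refine le_of_tendsto lim ?_
      filter_upwards [self_mem_nhdsWithin, mem_nhdsWithin_of_mem_nhds (gt_mem_nhds hr₀)] with r hr hr1
      have hr0 : 0 < r := hr
      have hr2 : r < |x₀ - s t₀| := hr1
      rw [div_le_iff₀ (by positivity)]
      refine (sym r).trans (le_of_eq ?_)
      simp only [hQ]
      rcases le_or_gt 0 (x₀ - s t₀) with h | h
      · rw [abs_of_nonneg h] at hr2 ⊢
        rw [abs_of_nonneg (by linarith), abs_of_nonneg (by linarith)]; ring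
      · rw [abs_of_neg h] at hr2 ⊢
        rw [abs_of_neg (by linarith), abs_of_neg (by linarith)]; ring
    -- The maximum may occur at `t₀ = T`, so only past times are compared.
    have d2 : 3 * ε ≤ d := by
      refine ge_of_tendsto hd.tendsto_slope_zero_left ?_
      have hev : ∀ᶠ h : ℝ in 𝓝[<] 0, -t₀ < h :=
        mem_nhdsWithin_of_mem_nhds (lt_mem_nhds (by linarith))
      filter_upwards [self_mem_nhdsWithin, hev] with h hh hh'
      have hneg : h < 0 := hh
      have a := hglob x₀ (t₀ + h) ⟨by linarith, by linarith [ht₀.2]⟩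
      have l := hs t₀ (t₀ + h)
      rw [show t₀ - (t₀ + h) = -h by ring, abs_neg, abs_of_neg hneg] at l
      have l2 : |x₀ - s t₀| - |x₀ - s (t₀ + h)| ≤ V * -h := by
        refine (abs_sub_abs_le_abs_sub _ _).trans (le_trans (le_of_eq ?_) l)
        rw [← abs_neg]; congr 1; ring
      rw [smul_eq_mul, inv_mul_eq_div, le_div_iff_of_neg hneg]
      have l3 := mul_le_mul_of_nonneg_left l2 hε0.le
      simp only [hφ, hQ] at a
      nlinarith
    linarith

lemma tendsto_symmetric_difference_of_caloricAt {F : ℝ → ℝ → ℝ} {x t : ℝ} (h : CaloricAt F x t) :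
    Tendsto (fun r => (F (x + r) t + F (x - r) t - 2 * F x t) / r) (𝓝[>] 0) (𝓝 0) := by
  obtain ⟨d, h1, -⟩ := h
  have h2 : Tendsto (fun r : ℝ => r) (𝓝[>] 0) (𝓝 0) := nhdsWithin_le_nhds
  have h3 := h1.mul h2
  rw [mul_zero] at h3
  refine h3.congr' ?_
  filter_upwards [self_mem_nhdsWithin] with r hr
  have : r ≠ 0 := ne_of_gt hr
  field_simp

/-- A bounded function that is caloric off a Lipschitz curve and has a prescribed gradient jump on
it is the sum of a heat flow and a single layer potential. -/
lemma eq_heatFlow_sub_layerPotential {U : ℝ → ℝ → ℝ} {f s b : ℝ → ℝ} {T V B A : ℝ}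
    (hf : Continuous f) (hb : Continuous b) (hfA : ∀ x, |f x| ≤ A) (hB : ∀ τ, |b τ| ≤ B)
    (hs : ∀ τ τ', |s τ - s τ'| ≤ V * |τ - τ'|)
    (hc : ContinuousOn (fun p : ℝ × ℝ => U p.1 p.2) (univ ×ˢ Icc 0 T))
    (hUA : ∀ x, ∀ t ∈ Icc 0 T, |U x t| ≤ A) (h0 : ∀ x, U x 0 = f x)
    (hoff : ∀ x, ∀ t ∈ Ioc 0 T, x ≠ s t → CaloricAt U x t)
    (hon : ∀ t ∈ Ioc 0 T,
      Tendsto (fun r => (U (s t + r) t + U (s t - r) t - 2 * U (s t) t) / r) (𝓝[>] 0) (𝓝 (b t)))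
    (x : ℝ) {t : ℝ} (ht : t ∈ Icc 0 T) : U x t = heatFlow f x t - layerPotential s b x t := by
  have hB0 : 0 ≤ B := (abs_nonneg _).trans (hB 0)
  have hV0 : 0 ≤ V := by simpa using (abs_nonneg _).trans (hs 1 0)
  have hsc : Continuous s := by
    refine LipschitzWith.continuous (K := ⟨V, hV0⟩) (LipschitzWith.of_dist_le_mul fun x y => ?_)
    exact hs x y
  set W : ℝ → ℝ → ℝ := fun x t => heatFlow f x t - layerPotential s b x t with hW
  have Wc : Continuous fun p : ℝ × ℝ => W p.1 p.2 :=
    (continuous_heatFlow hf hfA).sub (continuous_layerPotential hsc hb hB)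
  have W0 (x : ℝ) : W x 0 = f x := by simp [hW, heatFlow_zero, layerPotential]
  have Wb : ∀ x, ∀ t ∈ Icc 0 T, |W x t| ≤ √2 * A + B * (2 * √T) := by
    intro x t ht
    refine (abs_sub _ _).trans (add_le_add ?_ ?_)
    · simpa using weight_mul_abs_heatFlow_le (α := 0) le_rfl (by simpa using hfA) x ht.1
    · refine (abs_layerPotential_le hB x ht.1).trans ?_
      gcongr
      exact ht.2
  have Woff : ∀ x, ∀ t ∈ Ioc 0 T, x ≠ s t → CaloricAt W x t := fun x t ht hx =>
    (hasDerivAt_heatFlow hf hfA x ht.1).2.sub (hasDerivAt_layerPotential hsc hb hB ht.1 hx).2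
  have Won : ∀ t ∈ Ioc 0 T,
      Tendsto (fun r => (W (s t + r) t + W (s t - r) t - 2 * W (s t) t) / r) (𝓝[>] 0) (𝓝 (b t)) := by
    intro t ht
    have h1 := tendsto_symmetric_difference_of_caloricAt (hasDerivAt_heatFlow hf hfA (s t) ht.1).2
    have h2 := tendsto_symmetric_difference_layerPotential hb hB hs ht.1
    have h3 := h1.sub h2
    rw [zero_sub, neg_neg] at h3
    refine h3.congr fun r => ?_
    simp only [hW]; ring
  -- The jumps of `U` and `W` cancel, so the maximum principle applies to both differences.
  refine le_antisymm ?_ ?_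
  · rw [← sub_nonpos]
    refine nonpos_of_caloric_off_curve (D := fun x t => U x t - W x t) hs
      (hc.sub Wc.continuousOn) (B := A + (√2 * A + B * (2 * √T))) (fun x t ht => ?_)
      (fun x => by rw [h0, W0, sub_self]) (fun x t ht hx => (hoff x t ht hx).sub (Woff x t ht hx))
      (fun t ht => ?_) x t ht
    · linarith [abs_le.1 (hUA x t ht), abs_le.1 (Wb x t ht)]
    · have h3 := (hon t ht).sub (Won t ht)
      rw [sub_self] at h3
      refine h3.congr fun r => ?_
      ring
  · rw [← sub_nonpos]
    refine nonpos_of_caloric_off_curve (D := fun x t => W x t - U x t) hs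
      (Wc.continuousOn.sub hc) (B := A + (√2 * A + B * (2 * √T))) (fun x t ht => ?_)
      (fun x => by rw [h0, W0, sub_self]) (fun x t ht hx => (Woff x t ht hx).sub (hoff x t ht hx))
      (fun t ht => ?_) x t ht
    · linarith [abs_le.1 (hUA x t ht), abs_le.1 (Wb x t ht)]
    · have h3 := (Won t ht).sub (hon t ht)
      rw [sub_self] at h3
      refine h3.congr fun r => ?_
      ring

lemma tendsto_symmetric_second_difference_of_contDiffAt {f : ℝ → ℝ} {x : ℝ}
    (h : ContDiffAt ℝ 2 f x) :
    Tendsto (fun r => (f (x + r) + f (x - r) - 2 * f x) / r ^ 2) (𝓝[>] 0)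
      (𝓝 (iteratedDeriv 2 f x)) := by
  refine tendsto_symmetric_second_difference (f' := deriv f) ?_ ?_
  · filter_upwards [h.eventually (by simp)] with y hy
    exact (hy.differentiableAt (by simp)).hasDerivAt
  · have h1 : DifferentiableAt ℝ (deriv f) x := by
      have h2 : DifferentiableAt ℝ (fderiv ℝ f) x :=
        (h.fderiv_right (m := 1) (by norm_num)).differentiableAt (by simp)
      exact h2.clm_apply (differentiableAt_const (1 : ℝ))
    rw [show iteratedDeriv 2 f x = deriv (deriv f) x by
      rw [iteratedDeriv_succ, iteratedDeriv_one]]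
    exact h1.hasDerivAt

lemma tendsto_symmetric_difference_of_jump {f : ℝ → ℝ} {x p m : ℝ}
    (hp : HasDerivWithinAt f p (Ioi x) x) (hm : HasDerivWithinAt f m (Iio x) x) :
    Tendsto (fun r => (f (x + r) + f (x - r) - 2 * f x) / r) (𝓝[>] 0) (𝓝 (p - m)) := by
  have hp' := (hasDerivWithinAt_iff_tendsto_slope' (notMem_Ioi.2 le_rfl)).1 hp
  have hm' := (hasDerivWithinAt_iff_tendsto_slope' (notMem_Iio.2 le_rfl)).1 hm
  have tp : Tendsto (fun r : ℝ => x + r) (𝓝[>] 0) (𝓝[>] x) := by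
    refine tendsto_nhdsWithin_iff.2 ⟨?_, ?_⟩
    · have : Continuous fun r : ℝ => x + r := by fun_prop
      simpa using this.continuousWithinAt (s := Ioi 0) (x := 0) |>.tendsto
    · filter_upwards [self_mem_nhdsWithin] with r hr
      simpa using hr
  have tm : Tendsto (fun r : ℝ => x - r) (𝓝[>] 0) (𝓝[<] x) := by
    refine tendsto_nhdsWithin_iff.2 ⟨?_, ?_⟩
    · have : Continuous fun r : ℝ => x - r := by fun_prop
      simpa using this.continuousWithinAt (s := Ioi 0) (x := 0) |>.tendsto
    · filter_upwards [self_mem_nhdsWithin] with r hr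
      simpa using hr
  refine ((hp'.comp tp).sub (hm'.comp tm)).congr' ?_
  filter_upwards [self_mem_nhdsWithin] with r hr
  have : r ≠ 0 := ne_of_gt hr
  simp only [Function.comp, slope_def_field]
  rw [show x + r - x = r by ring, show x - r - x = -r by ring]
  field_simp
  ring

lemma MemC.abs_le {α : ℝ} {f : ℝ → ℝ} (h : MemC α f) (x : ℝ) :
    exp (α * |x|) * |f x| ≤ wnorm α f := le_ciSup h.2 x

lemma MemC.abs_le' {α : ℝ} (hα : 0 ≤ α) {f : ℝ → ℝ} (h : MemC α f) (x : ℝ) : |f x| ≤ wnorm α f :=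
  (le_mul_of_one_le_left (abs_nonneg _) (one_le_exp (by positivity))).trans (h.abs_le x)

/-- Each solution is represented by the heat flow of its initial values and a single layer
potential on its interface, after extending the velocity continuously to the whole line. -/
lemma IsSolution.representation {γ v₀ V₀ α σ : ℝ} {g f s v : ℝ → ℝ} {u : ℝ → ℝ → ℝ} (hγ : 0 < γ)
    (hg : IsKinetics v₀ V₀ g) (hα : 0 ≤ α) (hf : MemC α f) (h : IsSolution γ g f σ u s v) {T : ℝ}
    (hT : T ∈ Ioo 0 σ) :
    ∃ S w : ℝ → ℝ, Continuous w ∧ (∀ τ, |w τ| ≤ V₀) ∧ (∀ τ ∈ Ioc 0 T, w τ = v τ) ∧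
      (∀ t, S t = ∫ τ in (0 : ℝ)..t, w τ) ∧ (∀ t ∈ Icc 0 T, S t = s t) ∧
      ∀ x, ∀ t ∈ Icc 0 T, exp (γ * t) * u x t =
        heatFlow f x t - layerPotential S (fun τ => exp (γ * max 0 (min τ T)) * w τ) x t := by
  have hV0 : 0 < V₀ := hg.pos_upper
  have hvb : ∀ τ ∈ Ioo 0 σ, |v τ| ≤ V₀ := by
    intro τ hτ
    have h1 := hg.bounds _ (h.interface_nonneg τ hτ)
    rw [h.kinetic τ hτ] at h1
    have := hg.pos_lower
    rw [abs_le]; constructor <;> linarith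
  have hIcc : Icc 0 T ⊆ Ico 0 σ := fun τ hτ => ⟨hτ.1, hτ.2.trans_lt hT.2⟩
  -- Freezing time outside `[0, T]` extends the velocity continuously. The truncation changes
  -- nothing on `(0, T]`, where the kinetic condition gives `|v| ≤ V₀`; it secures the bound at time
  -- `0`, where that condition is not assumed.
  set w : ℝ → ℝ := fun τ => max (-V₀) (min V₀ (v (max 0 (min τ T)))) with hw
  have hclamp (τ : ℝ) : max 0 (min τ T) ∈ Icc 0 T :=
    ⟨le_max_left _ _, max_le hT.1.le (min_le_right _ _)⟩
  have hclamp' (τ : ℝ) (hτ : τ ∈ Icc 0 T) : max 0 (min τ T) = τ := by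
    rw [min_eq_left hτ.2, max_eq_right hτ.1]
  have wc : Continuous w := by
    have h1 : Continuous fun τ => v (max 0 (min τ T)) :=
      (h.velocity_cont.mono hIcc).comp_continuous (by fun_prop) hclamp
    exact continuous_const.max (continuous_const.min h1)
  have wb (τ : ℝ) : |w τ| ≤ V₀ := by
    rw [abs_le]
    exact ⟨le_max_left _ _, max_le (by linarith) (min_le_left _ _)⟩
  have wv : ∀ τ ∈ Ioc 0 T, w τ = v τ := by
    intro τ hτ
    have h1 := abs_le.1 (hvb τ ⟨hτ.1, hτ.2.trans_lt hT.2⟩)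
    simp only [hw]
    rw [hclamp' τ ⟨hτ.1.le, hτ.2⟩, min_eq_right h1.2, max_eq_right h1.1]
  set S : ℝ → ℝ := fun t => ∫ τ in (0 : ℝ)..t, w τ with hS
  have Ss : ∀ t ∈ Icc 0 T, S t = s t := by
    intro t ht
    rw [h.position t (hIcc ht)]
    refine intervalIntegral.integral_congr_ae (.of_forall fun τ hτ => ?_)
    rw [uIoc_of_le ht.1] at hτ
    exact wv τ ⟨hτ.1, hτ.2.trans ht.2⟩
  have SL (τ τ' : ℝ) : |S τ - S τ'| ≤ V₀ * |τ - τ'| := by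
    simp only [hS]
    rw [intervalIntegral.integral_interval_sub_left (wc.intervalIntegrable _ _)
      (wc.intervalIntegrable _ _), ← norm_eq_abs]
    exact intervalIntegral.norm_integral_le_of_norm_le_const fun x _ => wb x
  refine ⟨S, w, wc, wb, wv, fun t => rfl, Ss, ?_⟩
  obtain ⟨B, hB⟩ := h.bdd
  have hB0 : 0 ≤ B := (abs_nonneg _).trans (hB 0 0 ⟨le_rfl, hT.1.trans hT.2⟩)
  have hfB := hf.abs_le' hα
  have hf0 : 0 ≤ wnorm α f := (abs_nonneg _).trans (hfB 0)
  have eT : ∀ t, t ≤ T → exp (γ * t) ≤ exp (γ * T) := fun t ht => by gcongr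
  intro x t ht
  refine eq_heatFlow_sub_layerPotential (U := fun x t => exp (γ * t) * u x t)
    (A := wnorm α f + exp (γ * T) * B) (B := exp (γ * T) * V₀) hf.1 (by fun_prop) ?_ ?_ SL ?_ ?_ ?_ ?_
    ?_ x ht
  · intro x
    have : 0 ≤ exp (γ * T) * B := by positivity
    linarith [hfB x]
  · intro τ
    rw [abs_mul, abs_of_pos (exp_pos _)]
    gcongr
    · exact (hclamp τ).2
    · exact wb τ
  · refine ContinuousOn.mul (by fun_prop) (h.cont.mono (prod_mono subset_rfl hIcc))
  · intro x t ht
    rw [abs_mul, abs_of_pos (exp_pos _)]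
    have : exp (γ * t) * |u x t| ≤ exp (γ * T) * B :=
      mul_le_mul (eT t ht.2) (hB x t (hIcc ht)) (abs_nonneg _) (exp_pos _).le
    linarith
  · intro x
    simp [h.init]
  · intro x t ht hx
    have hp : (x, t) ∈ offInterface σ s :=
      ⟨ht.1, ht.2.trans_lt hT.2, by rw [← Ss t ⟨ht.1.le, ht.2⟩]; exact hx⟩
    refine ⟨exp (γ * t) * iteratedDeriv 2 (fun x => u x t) x, ?_, ?_⟩
    · refine ((tendsto_symmetric_second_difference_of_contDiffAt
        (h.space_smooth _ hp)).const_mul (exp (γ * t))).congr fun r => ?_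
      ring
    · have h1 : HasDerivAt (fun t => exp (γ * t)) (exp (γ * t) * γ) t := by
        have := ((hasDerivAt_id t).const_mul γ).exp
        simpa using this
      refine (h1.mul (h.heat _ hp)).congr_deriv ?_
      simp only
      ring
  · intro t ht
    rw [Ss t ⟨ht.1.le, ht.2⟩, hclamp' t ⟨ht.1.le, ht.2⟩, wv t ht]
    obtain ⟨p, m, h1, h2, h3⟩ := h.jump t ⟨ht.1, ht.2.trans_lt hT.2⟩
    rw [← h3]
    refine ((tendsto_symmetric_difference_of_jump h1 h2).const_mul (exp (γ * t))).congr fun r => ?_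
    ring

/-! ### Weighted estimates for kernels and layer potentials -/

lemma exp_weight_le {α d x y : ℝ} (hα : 0 ≤ α) (h : |y - x| ≤ d) :
    exp (α * |x|) ≤ exp (α * d) * exp (α * |y|) := by
  rw [← exp_add, ← mul_add]
  gcongr
  calc |x| = |y - (y - x)| := by ring_nf
    _ ≤ |y| + |y - x| := abs_sub _ _
    _ ≤ d + |y| := by linarith

lemma weight_mul_abs_heatKernel_sub_le {α θ d y δ₁ δ₂ : ℝ} (hα : 0 ≤ α) (hθ : 0 < θ) (hθ1 : θ ≤ 1)
    (h₁ : |δ₁| ≤ d) (h₂ : |δ₂| ≤ d) :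
    exp (α * |y|) * |heatKernel (y + δ₁) θ - heatKernel (y + δ₂) θ| ≤
      exp (α * d + 2 * α ^ 2) / θ * |δ₁ - δ₂| := by
  have hd (z : ℝ) (hz : |z - y| ≤ d) :
      ‖heatKernelX z θ‖ ≤ exp (-(α * |y|)) * (exp (α * d + 2 * α ^ 2) / θ) := by
    have h1 := weight_mul_abs_heatKernelX_le (α := α) z hθ
    have h2 := exp_weight_le hα hz
    have h3 : exp (-(z ^ 2 / (16 * θ))) ≤ 1 := by
      apply exp_le_one_iff.2
      have : 0 ≤ z ^ 2 / (16 * θ) := by positivity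
      linarith
    have h4 : exp (2 * α ^ 2 * θ) ≤ exp (2 * α ^ 2) :=
      exp_le_exp.2 (mul_le_of_le_one_right (by positivity) hθ1)
    rw [exp_neg, inv_mul_eq_div, le_div_iff₀ (exp_pos _), norm_eq_abs]
    calc |heatKernelX z θ| * exp (α * |y|) ≤
        |heatKernelX z θ| * (exp (α * d) * exp (α * |z|)) := by gcongr
      _ = exp (α * d) * (exp (α * |z|) * |heatKernelX z θ|) := by ring
      _ ≤ exp (α * d) * (exp (2 * α ^ 2 * θ) * exp (-(z ^ 2 / (16 * θ))) / θ) := by gcongr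
      _ ≤ exp (α * d) * (exp (2 * α ^ 2) * 1 / θ) := by gcongr
      _ = _ := by rw [exp_add]; ring
  have hm := Convex.norm_image_sub_le_of_norm_hasDerivWithin_le (f := fun z => heatKernel z θ)
    (f' := fun z => heatKernelX z θ) (s := Metric.closedBall y d)
    (fun z _ => (hasDerivAt_heatKernel_space z θ).hasDerivWithinAt)
    (fun z hz => hd z (by simpa [dist_eq] using hz)) (convex_closedBall y d)
    (x := y + δ₂) (y := y + δ₁) (by simpa [dist_eq] using h₂) (by simpa [dist_eq] using h₁)
  rw [add_sub_add_left_eq_sub, norm_eq_abs, norm_eq_abs] at hm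
  calc _ ≤ exp (α * |y|) * (exp (-(α * |y|)) * (exp (α * d + 2 * α ^ 2) / θ) * |δ₁ - δ₂|) := by
        gcongr
    _ = (exp (α * |y|) * exp (-(α * |y|))) * (exp (α * d + 2 * α ^ 2) / θ * |δ₁ - δ₂|) := by ring
    _ = _ := by rw [← exp_add]; simp

lemma intervalIntegrable_layer_integrand {s b : ℝ → ℝ} (hs : Continuous s) (hb : Continuous b)
    {B : ℝ} (hB : ∀ τ, |b τ| ≤ B) (x t : ℝ) :
    IntervalIntegrable (fun θ => heatKernel (x - s (t - θ)) θ * b (t - θ)) volume 0 t := by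
  refine ((intervalIntegrable_inv_sqrt 0 t).const_mul B).mono_fun' ?_
    (.of_forall fun θ => abs_layer_integrand_le hB x t θ)
  have h1 : Measurable fun θ => (x - s (t - θ), θ) := by fun_prop
  exact ((measurable_heatKernel.comp h1).mul (by fun_prop)).aestronglyMeasurable

/-- In the moving frames the two kernels are evaluated at `y + δ₁` and `y + δ₂` with `|δ₁ - δ₂| ≤ M
θ`. This cancels the `1/θ` of the mean value inequality and contributes `M B t`. The difference of
densities meets an integrable `θ^{-1/2}` and contributes `M' · 2√t`. -/
lemma weight_mul_abs_layerPotential_sub_le {s₁ s₂ b₁ b₂ : ℝ → ℝ} {α V B M M' t : ℝ} (hα : 0 ≤ α)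
    (hV : 0 ≤ V) (hM : 0 ≤ M) (ht : 0 ≤ t) (ht1 : t ≤ 1)
    (hs₁ : Continuous s₁) (hs₂ : Continuous s₂) (hb₁ : Continuous b₁) (hb₂ : Continuous b₂)
    (hB₁ : ∀ τ, |b₁ τ| ≤ B) (hB₂ : ∀ τ, |b₂ τ| ≤ B)
    (hV₁ : ∀ θ ∈ Ioc 0 t, |s₁ t - s₁ (t - θ)| ≤ V * θ)
    (hV₂ : ∀ θ ∈ Ioc 0 t, |s₂ t - s₂ (t - θ)| ≤ V * θ)
    (hM₁ : ∀ θ ∈ Ioc 0 t, |(s₁ t - s₁ (t - θ)) - (s₂ t - s₂ (t - θ))| ≤ M * θ)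
    (hM₂ : ∀ θ ∈ Ioc 0 t, |b₁ (t - θ) - b₂ (t - θ)| ≤ M') (y : ℝ) :
    exp (α * |y|) * |layerPotential s₁ b₁ (y + s₁ t) t - layerPotential s₂ b₂ (y + s₂ t) t| ≤
      exp (α * V + 2 * α ^ 2) * (M * B * t + M' * (2 * √t)) := by
  have hB0 : 0 ≤ B := (abs_nonneg _).trans (hB₁ 0)
  unfold layerPotential
  rw [← intervalIntegral.integral_sub (intervalIntegrable_layer_integrand hs₁ hb₁ hB₁ _ _)
    (intervalIntegrable_layer_integrand hs₂ hb₂ hB₂ _ _)]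
  have key : ‖∫ θ in (0 : ℝ)..t, heatKernel (y + s₁ t - s₁ (t - θ)) θ * b₁ (t - θ) -
      heatKernel (y + s₂ t - s₂ (t - θ)) θ * b₂ (t - θ)‖ ≤
      ∫ θ in (0 : ℝ)..t, exp (-(α * |y|)) * exp (α * V + 2 * α ^ 2) * (M * B + M' * (√θ)⁻¹) := by
    refine intervalIntegral.norm_integral_le_of_norm_le ht (.of_forall fun θ hθ => ?_) ?_
    · have hθ0 := hθ.1
      have hθ1 : θ ≤ 1 := hθ.2.trans ht1
      have v1 := hV₁ θ hθ
      have v2 := hV₂ θ hθ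
      have m1 := hM₁ θ hθ
      have m2 := hM₂ θ hθ
      rw [add_sub_assoc, add_sub_assoc]
      set δ₁ := s₁ t - s₁ (t - θ)
      set δ₂ := s₂ t - s₂ (t - θ)
      have hVθ : V * θ ≤ V := mul_le_of_le_one_right hV hθ1
      have a1 := weight_mul_abs_heatKernel_sub_le (y := y) hα hθ.1 hθ1 (v1.trans hVθ) (v2.trans hVθ)
      have a2 := weight_mul_heatKernel_le (α := α) (y + δ₂) hθ.1
      have a3 : exp (α * |y|) ≤ exp (α * V) * exp (α * |y + δ₂|) :=
        exp_weight_le hα (by simpa using v2.trans hVθ)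
      have a4 : exp (α * |y|) * heatKernel (y + δ₂) θ ≤ exp (α * V + 2 * α ^ 2) * (√θ)⁻¹ := by
        calc _ ≤ exp (α * V) * exp (α * |y + δ₂|) * heatKernel (y + δ₂) θ := by
              gcongr; exact heatKernel_nonneg _ _
          _ = exp (α * V) * (exp (α * |y + δ₂|) * heatKernel (y + δ₂) θ) := by ring
          _ ≤ exp (α * V) * (exp (α ^ 2 * θ) * (√θ)⁻¹) := by gcongr
          _ = exp (α * V + α ^ 2 * θ) * (√θ)⁻¹ := by rw [exp_add]; ring
          _ ≤ _ := by
            have e0 : α * V + α ^ 2 * θ ≤ α * V + 2 * α ^ 2 := by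
              linarith [mul_le_of_le_one_right (sq_nonneg α) hθ1, sq_nonneg α]
            exact mul_le_mul_of_nonneg_right (exp_le_exp.2 e0) (by positivity)
      have a5 : exp (α * V + 2 * α ^ 2) / θ * |δ₁ - δ₂| ≤ exp (α * V + 2 * α ^ 2) * M := by
        calc _ ≤ exp (α * V + 2 * α ^ 2) / θ * (M * θ) := by gcongr
          _ = _ := by have := hθ.1.ne'; field_simp
      have hM'0 : 0 ≤ M' := (abs_nonneg _).trans m2
      rw [mul_assoc, exp_neg, inv_mul_eq_div, le_div_iff₀ (exp_pos _), norm_eq_abs]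
      have e : heatKernel (y + δ₁) θ * b₁ (t - θ) - heatKernel (y + δ₂) θ * b₂ (t - θ) =
          (heatKernel (y + δ₁) θ - heatKernel (y + δ₂) θ) * b₁ (t - θ) +
            heatKernel (y + δ₂) θ * (b₁ (t - θ) - b₂ (t - θ)) := by ring
      calc _ ≤ (|heatKernel (y + δ₁) θ - heatKernel (y + δ₂) θ| * |b₁ (t - θ)| +
            heatKernel (y + δ₂) θ * |b₁ (t - θ) - b₂ (t - θ)|) * exp (α * |y|) := by
            gcongr
            rw [e]
            refine (abs_add_le _ _).trans (le_of_eq ?_)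
            rw [abs_mul, abs_mul, abs_of_nonneg (heatKernel_nonneg _ _)]
        _ = (exp (α * |y|) * |heatKernel (y + δ₁) θ - heatKernel (y + δ₂) θ|) * |b₁ (t - θ)| +
            (exp (α * |y|) * heatKernel (y + δ₂) θ) * |b₁ (t - θ) - b₂ (t - θ)| := by ring
        _ ≤ (exp (α * V + 2 * α ^ 2) * M) * B + (exp (α * V + 2 * α ^ 2) * (√θ)⁻¹) * M' :=
            add_le_add (mul_le_mul (a1.trans a5) (hB₁ _) (abs_nonneg _) (by positivity))
              (mul_le_mul a4 m2 (abs_nonneg _) (by positivity))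
        _ = _ := by ring
    · exact ((intervalIntegrable_const).add ((intervalIntegrable_inv_sqrt 0 t).const_mul M')).const_mul _
  rw [intervalIntegral.integral_const_mul, intervalIntegral.integral_add intervalIntegrable_const
    ((intervalIntegrable_inv_sqrt 0 t).const_mul M'), intervalIntegral.integral_const_mul M',
    integral_inv_sqrt ht, intervalIntegral.integral_const, norm_eq_abs, sub_zero, smul_eq_mul] at key
  calc _ ≤ exp (α * |y|) * (exp (-(α * |y|)) * exp (α * V + 2 * α ^ 2) *
        (t * (M * B) + M' * (2 * √t))) := by gcongr
    _ = (exp (α * |y|) * exp (-(α * |y|))) * (exp (α * V + 2 * α ^ 2) *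
        (M * B * t + M' * (2 * √t))) := by ring
    _ = _ := by rw [← exp_add]; simp

/-- The integrand is the derivative of `arctan (4√θ / a)`, so the bound is uniform in `a`, although
the integrand concentrates at `θ = 0` as `a → 0`. -/
lemma integral_arctan_kernel_le {a t : ℝ} (ha : 0 < a) (ht : 0 ≤ t) :
    IntervalIntegrable (fun θ => 2 * a / (√θ * (a ^ 2 + 16 * θ))) volume 0 t ∧
      ∫ θ in (0 : ℝ)..t, 2 * a / (√θ * (a ^ 2 + 16 * θ)) ≤ π / 2 := by
  have hc : ContinuousOn (fun θ : ℝ => arctan (4 * √θ / a)) (Icc 0 t) := by fun_prop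
  have hd : ∀ θ ∈ Ioo 0 t,
      HasDerivAt (fun θ : ℝ => arctan (4 * √θ / a)) (2 * a / (√θ * (a ^ 2 + 16 * θ))) θ := by
    intro θ hθ
    have hs : 0 < √θ := sqrt_pos.2 hθ.1
    refine ((((hasDerivAt_sqrt hθ.1.ne').const_mul 4).div_const a).arctan).congr_deriv ?_
    have e : (4 * √θ / a) ^ 2 = 16 * θ / a ^ 2 := by
      rw [div_pow, mul_pow, sq_sqrt hθ.1.le]; norm_num
    have := hθ.1
    rw [e]
    field_simp
    norm_num
  have hi : IntervalIntegrable (fun θ => 2 * a / (√θ * (a ^ 2 + 16 * θ))) volume 0 t := by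
    refine intervalIntegral.intervalIntegrable_deriv_of_nonneg
      (g := fun θ : ℝ => arctan (4 * √θ / a)) (by rwa [uIcc_of_le ht]) ?_ ?_
    · rwa [min_eq_left ht, max_eq_right ht]
    · rw [min_eq_left ht, max_eq_right ht]
      intro θ hθ
      have := hθ.1
      positivity
  refine ⟨hi, ?_⟩
  rw [intervalIntegral.integral_eq_sub_of_hasDerivAt_of_le ht hc hd hi]
  simp only [sqrt_zero, mul_zero, zero_div, arctan_zero, sub_zero]
  exact (arctan_lt_pi_div_two _).le

/-- The gradient stays bounded up to the curve from both sides. The dangerous part `|y| θ^{-3/2} exp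
(-(y²/(16θ)))` is reduced by `exp (-X) ≤ 1/(1 + X)` to the arctangent kernel with `a = |y|`; the
displacement `V θ` of the curve adds only an integrable `θ^{-1/2}`. -/
lemma weight_mul_abs_deriv_layerPotential_le {s b : ℝ → ℝ} {α V B t y : ℝ}
    (hV : 0 ≤ V) (hB : ∀ τ, |b τ| ≤ B) (ht : 0 ≤ t) (ht1 : t ≤ 1)
    (hs : ∀ τ τ', |s τ - s τ'| ≤ V * |τ - τ'|) (hy : y ≠ 0) :
    exp (α * |y|) * |∫ θ in (0 : ℝ)..t, heatKernelX (y + s t - s (t - θ)) θ * b (t - θ)| ≤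
      exp (V ^ 2 / 4 + 4 * α ^ 2) * (2 * π + V) * B := by
  have hB0 : 0 ≤ B := (abs_nonneg _).trans (hB 0)
  have hy0 : 0 < |y| := abs_pos.2 hy
  obtain ⟨hi, hle⟩ := integral_arctan_kernel_le hy0 ht
  set K := exp (V ^ 2 / 4 + 4 * α ^ 2)
  have key : ‖∫ θ in (0 : ℝ)..t, heatKernelX (y + s t - s (t - θ)) θ * b (t - θ)‖ ≤
      ∫ θ in (0 : ℝ)..t, exp (-(α * |y|)) * K * B *
        (4 * (2 * |y| / (√θ * (|y| ^ 2 + 16 * θ))) + V / 2 * (√θ)⁻¹) := by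
    refine intervalIntegral.norm_integral_le_of_norm_le ht (.of_forall fun θ hθ => ?_) ?_
    · have hθ0 := hθ.1
      have hθ1 : θ ≤ 1 := hθ.2.trans ht1
      have hsθ : 0 < √θ := sqrt_pos.2 hθ0
      have hl := hs t (t - θ)
      rw [sub_sub_cancel, abs_of_pos hθ0] at hl
      rw [add_sub_assoc]
      set δ := s t - s (t - θ)
      have e1 : α * |y| + -((y + δ) ^ 2 / (4 * θ)) ≤
          V ^ 2 / 4 + 4 * α ^ 2 + -(y ^ 2 / (16 * θ)) := by
        have h1 : y ^ 2 / 2 - V ^ 2 * θ ^ 2 ≤ (y + δ) ^ 2 := by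
          have : δ ^ 2 ≤ (V * θ) ^ 2 := by rw [← sq_abs δ]; gcongr
          nlinarith [sq_nonneg (y + 2 * δ)]
        have h2 : y ^ 2 / (8 * θ) - V ^ 2 * θ / 4 ≤ (y + δ) ^ 2 / (4 * θ) := by
          have : y ^ 2 / (8 * θ) - V ^ 2 * θ / 4 = (y ^ 2 / 2 - V ^ 2 * θ ^ 2) / (4 * θ) := by
            field_simp; ring
          rw [this]; gcongr
        have h3 : 4 * α ^ 2 * θ - α * |y| + y ^ 2 / (16 * θ) = (8 * α * θ - |y|) ^ 2 / (16 * θ) := by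
          field_simp
          rw [← sq_abs y]; ring
        have h4 : 0 ≤ (8 * α * θ - |y|) ^ 2 / (16 * θ) := by positivity
        have h5 : 4 * α ^ 2 * θ ≤ 4 * α ^ 2 := mul_le_of_le_one_right (by positivity) hθ1
        have h6 : V ^ 2 * θ ≤ V ^ 2 := mul_le_of_le_one_right (by positivity) hθ1
        have h7 : y ^ 2 / (8 * θ) = y ^ 2 / (16 * θ) + y ^ 2 / (16 * θ) := by field_simp; ring
        linarith
      have e2 : exp (-(y ^ 2 / (16 * θ))) ≤ 16 * θ / (|y| ^ 2 + 16 * θ) := by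
        rw [exp_neg, inv_le_comm₀ (exp_pos _) (by positivity), inv_div]
        refine le_trans (le_of_eq ?_) (add_one_le_exp (y ^ 2 / (16 * θ)))
        rw [sq_abs]; field_simp
      have e3 : exp (-(y ^ 2 / (16 * θ))) ≤ 1 := by
        apply exp_le_one_iff.2
        have : 0 ≤ y ^ 2 / (16 * θ) := by positivity
        linarith
      have e4 : exp (α * |y|) * |heatKernelX (y + δ) θ| ≤
          K * (4 * (2 * |y| / (√θ * (|y| ^ 2 + 16 * θ))) + V / 2 * (√θ)⁻¹) := by
        unfold heatKernelX heatKernel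
        rw [abs_mul, abs_neg, abs_div, abs_of_pos (by positivity : 0 < 2 * θ), abs_mul,
          abs_of_pos (exp_pos _), abs_of_nonneg (by positivity : 0 ≤ (√(4 * π * θ))⁻¹)]
        calc _ = |y + δ| / (2 * θ) * (√(4 * π * θ))⁻¹ *
              (exp (α * |y|) * exp (-((y + δ) ^ 2 / (4 * θ)))) := by ring
          _ ≤ (|y| + V * θ) / (2 * θ) * (√θ)⁻¹ * (K * exp (-(y ^ 2 / (16 * θ)))) := by
            rw [← exp_add, ← exp_add]
            gcongr
            · exact (abs_add_le _ _).trans (by gcongr)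
            · exact le_four_pi_mul hθ0
          _ = K * (|y| / (2 * θ) * (√θ)⁻¹ * exp (-(y ^ 2 / (16 * θ))) +
              V / 2 * (√θ)⁻¹ * exp (-(y ^ 2 / (16 * θ)))) := by field_simp
          _ ≤ K * (|y| / (2 * θ) * (√θ)⁻¹ * (16 * θ / (|y| ^ 2 + 16 * θ)) +
              V / 2 * (√θ)⁻¹ * 1) := by gcongr
          _ = _ := by field_simp; ring
      rw [norm_mul, norm_eq_abs, norm_eq_abs, exp_neg]
      calc _ = (exp (α * |y|))⁻¹ * (exp (α * |y|) * |heatKernelX (y + δ) θ|) * |b (t - θ)| := by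
            have := (exp_pos (α * |y|)).ne'
            field_simp
        _ ≤ (exp (α * |y|))⁻¹ *
            (K * (4 * (2 * |y| / (√θ * (|y| ^ 2 + 16 * θ))) + V / 2 * (√θ)⁻¹)) * B := by
            gcongr
            exact hB _
        _ = _ := by ring
    · exact ((hi.const_mul 4).add ((intervalIntegrable_inv_sqrt 0 t).const_mul _)).const_mul _
  rw [intervalIntegral.integral_const_mul, intervalIntegral.integral_add (hi.const_mul 4)
    ((intervalIntegrable_inv_sqrt 0 t).const_mul _), intervalIntegral.integral_const_mul,
    intervalIntegral.integral_const_mul, integral_inv_sqrt ht, norm_eq_abs] at key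
  have hst : √t ≤ 1 := sqrt_le_one.2 ht1
  calc _ ≤ exp (α * |y|) * (exp (-(α * |y|)) * K * B *
        (4 * (∫ θ in (0 : ℝ)..t, 2 * |y| / (√θ * (|y| ^ 2 + 16 * θ))) + V / 2 * (2 * √t))) := by gcongr
    _ ≤ exp (α * |y|) * (exp (-(α * |y|)) * K * B * (4 * (π / 2) + V / 2 * (2 * 1))) := by gcongr
    _ = (exp (α * |y|) * exp (-(α * |y|))) * (K * (2 * π + V) * B) := by ring
    _ = _ := by rw [← exp_add]; simp

/-- The potential is continuous but has a kink on the interface, at `0` in the moving frame.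
Splitting there shows that the kink does not spoil a Lipschitz bound. -/
lemma abs_sub_le_of_deriv_off_zero {f f' : ℝ → ℝ} {L a b : ℝ} (hab : a ≤ b)
    (hc : Continuous f) (hd : ∀ z, z ≠ 0 → HasDerivAt f (f' z) z)
    (hL : ∀ z ∈ Ioo a b, z ≠ 0 → |f' z| ≤ L) : |f b - f a| ≤ L * (b - a) := by
  have base : ∀ c d, a ≤ c → c ≤ d → d ≤ b → (0 : ℝ) ∉ Ioo c d → |f d - f c| ≤ L * (d - c) := by
    intro c d hac hcd hdb h0
    rcases hcd.eq_or_lt with rfl | hlt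
    · simp
    have hne : ∀ z ∈ Ioo c d, z ≠ 0 := fun z hz h => h0 (h ▸ hz)
    obtain ⟨z, hz, he⟩ := exists_hasDerivAt_eq_slope f f' hlt hc.continuousOn
      fun z hz => hd z (hne z hz)
    have h1 := hL z ⟨hac.trans_lt hz.1, hz.2.trans_le hdb⟩ (hne z hz)
    have hp : 0 < d - c := sub_pos.2 hlt
    rwa [he, abs_div, abs_of_pos hp, div_le_iff₀ hp] at h1
  by_cases h0 : (0 : ℝ) ∈ Ioo a b
  · have h1 := base a 0 le_rfl h0.1.le h0.2.le (by simp)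
    have h2 := base 0 b h0.1.le h0.2.le le_rfl (by simp)
    calc |f b - f a| = |(f b - f 0) + (f 0 - f a)| := by ring_nf
      _ ≤ _ := (abs_add_le _ _).trans (by linarith)
  · exact base a b le_rfl hab le_rfl h0

lemma weight_mul_abs_layerPotential_translate_le {s b : ℝ → ℝ} {α V B t : ℝ} (hα : 0 ≤ α)
    (hV : 0 ≤ V) (hb : Continuous b) (hB : ∀ τ, |b τ| ≤ B) (ht : 0 < t) (ht1 : t ≤ 1)
    (hs : ∀ τ τ', |s τ - s τ'| ≤ V * |τ - τ'|) {x y₁ y₂ d : ℝ}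
    (h₁ : |y₁ - x| ≤ d) (h₂ : |y₂ - x| ≤ d) :
    exp (α * |x|) * |layerPotential s b (y₁ + s t) t - layerPotential s b (y₂ + s t) t| ≤
      exp (α * d) * (exp (V ^ 2 / 4 + 4 * α ^ 2) * (2 * π + V) * B) * |y₁ - y₂| := by
  wlog h12 : y₁ ≤ y₂ generalizing y₁ y₂
  · have := this h₂ h₁ (not_le.1 h12).le
    rwa [abs_sub_comm, abs_sub_comm y₂] at this
  have hsc : Continuous s := by
    refine LipschitzWith.continuous (K := ⟨V, hV⟩) (LipschitzWith.of_dist_le_mul fun x y => ?_)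
    exact hs x y
  set C := exp (V ^ 2 / 4 + 4 * α ^ 2) * (2 * π + V) * B
  have hm := abs_sub_le_of_deriv_off_zero (f := fun z => layerPotential s b (z + s t) t)
    (f' := fun z => ∫ θ in (0 : ℝ)..t, heatKernelX (z + s t - s (t - θ)) θ * b (t - θ))
    (L := exp (-(α * |x|)) * (exp (α * d) * C)) h12
    ((continuous_layerPotential hsc hb hB).comp (by fun_prop : Continuous fun z : ℝ => (z + s t, t)))
    (fun z hz => (hasDerivAt_layerPotential hsc hb hB ht (x₀ := z + s t)
      (by simpa using hz)).1.comp_add_const z (s t)) ?_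
  · rw [abs_sub_comm, abs_sub_comm y₁, abs_of_nonneg (sub_nonneg.2 h12)]
    calc _ ≤ exp (α * |x|) * (exp (-(α * |x|)) * (exp (α * d) * C) * (y₂ - y₁)) := by gcongr
      _ = (exp (α * |x|) * exp (-(α * |x|))) * (exp (α * d) * C * (y₂ - y₁)) := by ring
      _ = _ := by rw [← exp_add]; simp
  · intro z hz hz0
    have h1 := weight_mul_abs_deriv_layerPotential_le (α := α) hV hB ht.le ht1 hs hz0
    have hzd : |z - x| ≤ d := by
      rw [abs_le] at *
      exact ⟨by linarith [hz.1], by linarith [hz.2]⟩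
    have h2 := exp_weight_le hα hzd
    rw [exp_neg, inv_mul_eq_div, le_div_iff₀ (exp_pos _)]
    calc _ ≤ |∫ θ in (0 : ℝ)..t, heatKernelX (z + s t - s (t - θ)) θ * b (t - θ)| *
          (exp (α * d) * exp (α * |z|)) := by gcongr
      _ = exp (α * d) * (exp (α * |z|) *
          |∫ θ in (0 : ℝ)..t, heatKernelX (z + s t - s (t - θ)) θ * b (t - θ)|) := by ring
      _ ≤ _ := by gcongr

/-! ### Comparison of the fields generated by two interfaces -/

/-- `s` is the primitive, vanishing at time zero, of the continuous velocity `w` with `|w| ≤ V`. -/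
structure IsPath (V : ℝ) (s w : ℝ → ℝ) : Prop where
  cont : Continuous w
  bdd : ∀ τ, |w τ| ≤ V
  primitive : ∀ t, s t = ∫ τ in (0 : ℝ)..t, w τ

lemma IsPath.sub_eq {V : ℝ} {s w : ℝ → ℝ} (h : IsPath V s w) (t t' : ℝ) :
    s t - s t' = ∫ τ in t'..t, w τ := by
  rw [h.primitive, h.primitive, intervalIntegral.integral_interval_sub_left
    (h.cont.intervalIntegrable _ _) (h.cont.intervalIntegrable _ _)]

lemma IsPath.lipschitz {V : ℝ} {s w : ℝ → ℝ} (h : IsPath V s w) (t t' : ℝ) :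
    |s t - s t'| ≤ V * |t - t'| := by
  rw [h.sub_eq, ← norm_eq_abs]
  exact intervalIntegral.norm_integral_le_of_norm_le_const fun x _ => h.bdd x

lemma IsPath.nonneg {V : ℝ} {s w : ℝ → ℝ} (h : IsPath V s w) : 0 ≤ V :=
  (abs_nonneg _).trans (h.bdd 0)

lemma IsPath.continuous {V : ℝ} {s w : ℝ → ℝ} (h : IsPath V s w) : Continuous s := by
  refine LipschitzWith.continuous (K := ⟨V, h.nonneg⟩) (LipschitzWith.of_dist_le_mul fun x y => ?_)
  exact h.lipschitz x y

lemma IsPath.abs_le {V : ℝ} {s w : ℝ → ℝ} (h : IsPath V s w) {t : ℝ} (ht : 0 ≤ t) (ht1 : t ≤ 1) :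
    |s t| ≤ V := by
  have h1 := h.lipschitz t 0
  rw [show s 0 = 0 by simp [h.primitive], sub_zero, sub_zero, abs_of_nonneg ht] at h1
  exact h1.trans (mul_le_of_le_one_right h.nonneg ht1)

lemma IsPath.abs_sub_sub_le {V M T : ℝ} {s₁ w₁ s₂ w₂ : ℝ → ℝ} (h₁ : IsPath V s₁ w₁)
    (h₂ : IsPath V s₂ w₂) (hM : ∀ τ ∈ Icc 0 T, |w₁ τ - w₂ τ| ≤ M) {t t' : ℝ} (ht' : 0 ≤ t')
    (htt : t' ≤ t) (ht : t ≤ T) : |(s₁ t - s₁ t') - (s₂ t - s₂ t')| ≤ M * (t - t') := by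
  rw [h₁.sub_eq, h₂.sub_eq, ← intervalIntegral.integral_sub (h₁.cont.intervalIntegrable _ _)
    (h₂.cont.intervalIntegrable _ _), ← norm_eq_abs, ← abs_of_nonneg (sub_nonneg.2 htt)]
  refine intervalIntegral.norm_integral_le_of_norm_le_const fun τ hτ => ?_
  rw [uIoc_of_le htt] at hτ
  exact hM τ ⟨ht'.trans hτ.1.le, hτ.2.trans ht⟩

/-- The temperature field, up to the factor `e^{γ t}`, generated by the initial values `f` and the
interface `s` with velocity `w`, on the time interval `[0, T]`. -/
def generatedField (γ T : ℝ) (f s w : ℝ → ℝ) (x t : ℝ) : ℝ :=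
  heatFlow f x t - layerPotential s (fun τ => exp (γ * max 0 (min τ T)) * w τ) x t

lemma abs_density_le {γ T V : ℝ} (hγ : 0 ≤ γ) (hT1 : T ≤ 1) {s w : ℝ → ℝ} (h : IsPath V s w) (τ : ℝ) :
    |exp (γ * max 0 (min τ T)) * w τ| ≤ exp γ * V := by
  rw [abs_mul, abs_of_pos (exp_pos _)]
  gcongr
  · exact mul_le_of_le_one_right hγ (max_le zero_le_one ((min_le_right _ _).trans hT1))
  · exact h.bdd τ

/-- There are three contributions: the heat flow of the difference of data, giving `Δ`; one heat
flow at points at distance at most `M t`, where the gradient `t^{-1/2}` leaves `√t M`; and the layer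
potentials in their moving frames, using `t ≤ √t`. -/
lemma weight_mul_abs_generatedField_sub_le {γ T V α R Δ M : ℝ} {f₁ f₂ s₁ s₂ w₁ w₂ : ℝ → ℝ}
    (hγ : 0 ≤ γ) (hα : 0 ≤ α) (hT1 : T ≤ 1) (hf₁ : Continuous f₁) (hf₂ : Continuous f₂)
    (hR₁ : ∀ x, exp (α * |x|) * |f₁ x| ≤ R) (hR₂ : ∀ x, exp (α * |x|) * |f₂ x| ≤ R)
    (hΔ : ∀ x, exp (α * |x|) * |f₁ x - f₂ x| ≤ Δ) (h₁ : IsPath V s₁ w₁) (h₂ : IsPath V s₂ w₂)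
    (hM : ∀ τ ∈ Icc 0 T, |w₁ τ - w₂ τ| ≤ M) {t : ℝ} (ht : t ∈ Ioc 0 T) (y : ℝ) :
    exp (α * |y|) * |generatedField γ T f₁ s₁ w₁ (y + s₁ t) t -
        generatedField γ T f₂ s₂ w₂ (y + s₂ t) t| ≤
      exp (α * V + 2 * α ^ 2) * (√2 * Δ + (4 * √π * R + exp γ * (V + 2)) * √t * M) := by
  have ht0 : 0 < t := ht.1
  have ht1 : t ≤ 1 := ht.2.trans hT1
  have hV := h₁.nonneg
  have hM0 : 0 ≤ M := (abs_nonneg _).trans (hM t ⟨ht0.le, ht.2⟩)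
  have hR0 : 0 ≤ R := le_trans (by positivity) (hR₁ 0)
  have hΔ0 : 0 ≤ Δ := le_trans (by positivity) (hΔ 0)
  have hst : 0 < √t := sqrt_pos.2 ht0
  have hst2 : √t * √t = t := mul_self_sqrt ht0.le
  have hts : t ≤ √t := by
    have : √t ≤ 1 := sqrt_le_one.2 ht1
    nlinarith
  have bd {f : ℝ → ℝ} (h : ∀ x, exp (α * |x|) * |f x| ≤ R) (x : ℝ) : |f x| ≤ R :=
    (le_mul_of_one_le_left (abs_nonneg _) (one_le_exp (by positivity))).trans (h x)
  have e2 : exp (2 * α ^ 2 * t) ≤ exp (2 * α ^ 2) :=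
    exp_le_exp.2 (mul_le_of_le_one_right (by positivity) ht1)
  have hs0 {s w : ℝ → ℝ} (h : IsPath V s w) : s 0 = 0 := by simp [h.primitive]
  have hss : |s₁ t - s₂ t| ≤ M * t := by
    have := h₁.abs_sub_sub_le h₂ hM le_rfl ht0.le ht.2
    simpa [hs0 h₁, hs0 h₂] using this
  have H1 : exp (α * |y|) * |heatFlow f₁ (y + s₁ t) t - heatFlow f₂ (y + s₁ t) t| ≤
      exp (α * V + 2 * α ^ 2) * (√2 * Δ) := by
    rw [← heatFlow_sub hf₁ hf₂ (bd hR₁) (bd hR₂)]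
    have a1 := weight_mul_abs_heatFlow_le hα hΔ (y + s₁ t) ht0.le
    have a2 : exp (α * |y|) ≤ exp (α * V) * exp (α * |y + s₁ t|) :=
      exp_weight_le hα (by simpa using h₁.abs_le ht0.le ht1)
    calc _ ≤ exp (α * V) * exp (α * |y + s₁ t|) *
          |heatFlow (fun x => f₁ x - f₂ x) (y + s₁ t) t| := by gcongr
      _ = exp (α * V) * (exp (α * |y + s₁ t|) *
          |heatFlow (fun x => f₁ x - f₂ x) (y + s₁ t) t|) := by ring
      _ ≤ exp (α * V) * (√2 * exp (2 * α ^ 2 * t) * Δ) := by gcongr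
      _ ≤ exp (α * V) * (√2 * exp (2 * α ^ 2) * Δ) := by gcongr
      _ = _ := by rw [exp_add]; ring
  have H2 : exp (α * |y|) * |heatFlow f₂ (y + s₁ t) t - heatFlow f₂ (y + s₂ t) t| ≤
      exp (α * V + 2 * α ^ 2) * (4 * √π * R * √t * M) := by
    refine (weight_mul_abs_heatFlow_sub_le hf₂ hα hR₂ ht0 (d := V)
      (by simpa using h₁.abs_le ht0.le ht1) (by simpa using h₂.abs_le ht0.le ht1)).trans ?_
    rw [add_sub_add_left_eq_sub]
    calc _ ≤ exp (α * V) * (exp (2 * α ^ 2) * (4 * √π) / √t * R) * (M * t) := by gcongr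
      _ = exp (α * V) * (exp (2 * α ^ 2) * (4 * √π) / √t * R) * (M * (√t * √t)) := by rw [hst2]
      _ = _ := by rw [exp_add]; field_simp
  have H3 := weight_mul_abs_layerPotential_sub_le (s₁ := s₁) (s₂ := s₂)
    (b₁ := fun τ => exp (γ * max 0 (min τ T)) * w₁ τ)
    (b₂ := fun τ => exp (γ * max 0 (min τ T)) * w₂ τ) (V := V) (B := exp γ * V) (M := M)
    (M' := exp γ * M) hα hV hM0 ht0.le ht1 h₁.continuous h₂.continuous
    (by have := h₁.cont; fun_prop) (by have := h₂.cont; fun_prop)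
    (abs_density_le hγ hT1 h₁) (abs_density_le hγ hT1 h₂)
    (fun θ hθ => by simpa [abs_of_pos hθ.1] using h₁.lipschitz t (t - θ))
    (fun θ hθ => by simpa [abs_of_pos hθ.1] using h₂.lipschitz t (t - θ))
    (fun θ hθ => by
      simpa using h₁.abs_sub_sub_le h₂ hM (sub_nonneg.2 hθ.2) (sub_le_self t hθ.1.le) ht.2)
    (fun θ hθ => by
      rw [← mul_sub, abs_mul, abs_of_pos (exp_pos _)]
      gcongr
      · exact mul_le_of_le_one_right hγ (max_le zero_le_one ((min_le_right _ _).trans hT1))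
      · exact hM _ ⟨sub_nonneg.2 hθ.2, by linarith [hθ.1, ht.2]⟩) y
  have H3' : exp (α * V + 2 * α ^ 2) * (M * (exp γ * V) * t + exp γ * M * (2 * √t)) ≤
      exp (α * V + 2 * α ^ 2) * (exp γ * (V + 2) * √t * M) := by
    calc _ ≤ exp (α * V + 2 * α ^ 2) * (M * (exp γ * V) * √t + exp γ * M * (2 * √t)) := by gcongr
      _ = _ := by ring
  unfold generatedField
  set P₁ := layerPotential s₁ (fun τ => exp (γ * max 0 (min τ T)) * w₁ τ) (y + s₁ t) t
  set P₂ := layerPotential s₂ (fun τ => exp (γ * max 0 (min τ T)) * w₂ τ) (y + s₂ t) t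
  have tri : |heatFlow f₁ (y + s₁ t) t - P₁ - (heatFlow f₂ (y + s₂ t) t - P₂)| ≤
      |heatFlow f₁ (y + s₁ t) t - heatFlow f₂ (y + s₁ t) t| +
      |heatFlow f₂ (y + s₁ t) t - heatFlow f₂ (y + s₂ t) t| + |P₁ - P₂| := by
    have e : heatFlow f₁ (y + s₁ t) t - P₁ - (heatFlow f₂ (y + s₂ t) t - P₂) =
      (heatFlow f₁ (y + s₁ t) t - heatFlow f₂ (y + s₁ t) t) +
      (heatFlow f₂ (y + s₁ t) t - heatFlow f₂ (y + s₂ t) t) + -(P₁ - P₂) := by ring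
    rw [e, ← abs_neg (P₁ - P₂)]
    exact abs_add_three _ _ _
  have := mul_le_mul_of_nonneg_left tri (exp_pos (α * |y|)).le
  refine this.trans ?_
  rw [mul_add, mul_add]
  calc _ ≤ exp (α * V + 2 * α ^ 2) * (√2 * Δ) + exp (α * V + 2 * α ^ 2) * (4 * √π * R * √t * M) +
        exp (α * V + 2 * α ^ 2) * (exp γ * (V + 2) * √t * M) :=
        add_le_add (add_le_add H1 H2) (H3.trans H3')
    _ = _ := by ring

/-- The factor `1/√t` comes from the heat flow of merely continuous data; the layer part has bounded
gradient. The radius `2 V` accommodates the reflected points `x - 2 s`. -/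
lemma weight_mul_abs_generatedField_translate_le {γ T V α R : ℝ} {f s w : ℝ → ℝ}
    (hγ : 0 ≤ γ) (hα : 0 ≤ α) (hT1 : T ≤ 1) (hf : Continuous f)
    (hR : ∀ x, exp (α * |x|) * |f x| ≤ R) (h : IsPath V s w) {t : ℝ} (ht : t ∈ Ioc 0 T)
    {x y₁ y₂ : ℝ} (h₁ : |y₁ - x| ≤ 2 * V) (h₂ : |y₂ - x| ≤ 2 * V) :
    exp (α * |x|) * |generatedField γ T f s w (y₁ + s t) t -
        generatedField γ T f s w (y₂ + s t) t| ≤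
      exp (3 * α * V + 4 * α ^ 2 + V ^ 2 / 4) *
        (4 * √π * R + (2 * π + V) * (exp γ * V)) * (|y₁ - y₂| / √t) := by
  have ht0 : 0 < t := ht.1
  have ht1 : t ≤ 1 := ht.2.trans hT1
  have hV := h.nonneg
  have hR0 : 0 ≤ R := le_trans (by positivity) (hR 0)
  have hst : 0 < √t := sqrt_pos.2 ht0
  have hst1 : √t ≤ 1 := sqrt_le_one.2 ht1
  have hs := h.abs_le ht0.le ht1
  have d3 (y : ℝ) (hy : |y - x| ≤ 2 * V) : |y + s t - x| ≤ 3 * V := by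
    rw [show y + s t - x = (y - x) + s t by ring]
    exact (abs_add_le _ _).trans (by linarith)
  set E := exp (3 * α * V + 4 * α ^ 2 + V ^ 2 / 4)
  have H1 : exp (α * |x|) * |heatFlow f (y₁ + s t) t - heatFlow f (y₂ + s t) t| ≤
      E * (4 * √π * R) * (|y₁ - y₂| / √t) := by
    refine (weight_mul_abs_heatFlow_sub_le hf hα hR ht0 (d3 y₁ h₁) (d3 y₂ h₂)).trans ?_
    rw [add_sub_add_right_eq_sub]
    have e : exp (α * (3 * V)) * exp (2 * α ^ 2 * t) ≤ E := by
      rw [← exp_add]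
      apply exp_le_exp.2
      have : 2 * α ^ 2 * t ≤ 2 * α ^ 2 := mul_le_of_le_one_right (by positivity) ht1
      nlinarith [sq_nonneg α, sq_nonneg V]
    calc _ = (exp (α * (3 * V)) * exp (2 * α ^ 2 * t)) * (4 * √π * R) * (|y₁ - y₂| / √t) := by ring
      _ ≤ _ := by gcongr
  have H2 := weight_mul_abs_layerPotential_translate_le (s := s)
    (b := fun τ => exp (γ * max 0 (min τ T)) * w τ) hα hV (by have := h.cont; fun_prop)
    (abs_density_le hγ hT1 h) ht0 ht1 h.lipschitz h₁ h₂
  have H2' : exp (α * (2 * V)) * (exp (V ^ 2 / 4 + 4 * α ^ 2) * (2 * π + V) * (exp γ * V)) * |y₁ - y₂|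
      ≤ E * ((2 * π + V) * (exp γ * V)) * (|y₁ - y₂| / √t) := by
    have e : exp (α * (2 * V)) * exp (V ^ 2 / 4 + 4 * α ^ 2) ≤ E := by
      rw [← exp_add]
      apply exp_le_exp.2
      nlinarith [mul_nonneg hα hV]
    have e2 : |y₁ - y₂| ≤ |y₁ - y₂| / √t := by
      rw [le_div_iff₀ hst]
      exact mul_le_of_le_one_right (abs_nonneg _) hst1
    calc _ = (exp (α * (2 * V)) * exp (V ^ 2 / 4 + 4 * α ^ 2)) * ((2 * π + V) * (exp γ * V)) *
          |y₁ - y₂| := by ring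
      _ ≤ _ := by gcongr
  unfold generatedField
  set P₁ := layerPotential s (fun τ => exp (γ * max 0 (min τ T)) * w τ) (y₁ + s t) t
  set P₂ := layerPotential s (fun τ => exp (γ * max 0 (min τ T)) * w τ) (y₂ + s t) t
  have tri : |heatFlow f (y₁ + s t) t - P₁ - (heatFlow f (y₂ + s t) t - P₂)| ≤
      |heatFlow f (y₁ + s t) t - heatFlow f (y₂ + s t) t| + |P₁ - P₂| := by
    rw [sub_sub_sub_comm]
    exact abs_sub _ _
  refine (mul_le_mul_of_nonneg_left tri (exp_pos (α * |x|)).le).trans ?_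
  rw [mul_add]
  exact (add_le_add H1 (H2.trans H2')).trans (le_of_eq (by ring))

/-- The intermediate value is the second field at `(x - 2 s₁) + s₂`. Against the first field it is
the moving-frame comparison at `x - 2 s₁`; against the second it is a translation by `2 (s₁ - s₂)`.
-/
lemma weight_mul_abs_generatedField_reflected_sub_le {γ T V α R Δ M : ℝ}
    {f₁ f₂ s₁ s₂ w₁ w₂ : ℝ → ℝ}
    (hγ : 0 ≤ γ) (hα : 0 ≤ α) (hT1 : T ≤ 1) (hf₁ : Continuous f₁) (hf₂ : Continuous f₂)
    (hR₁ : ∀ x, exp (α * |x|) * |f₁ x| ≤ R) (hR₂ : ∀ x, exp (α * |x|) * |f₂ x| ≤ R)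
    (hΔ : ∀ x, exp (α * |x|) * |f₁ x - f₂ x| ≤ Δ) (h₁ : IsPath V s₁ w₁) (h₂ : IsPath V s₂ w₂)
    (hM : ∀ τ ∈ Icc 0 T, |w₁ τ - w₂ τ| ≤ M) {t : ℝ} (ht : t ∈ Ioc 0 T) (x : ℝ) :
    exp (α * |x|) * |generatedField γ T f₁ s₁ w₁ (x - s₁ t) t -
        generatedField γ T f₂ s₂ w₂ (x - s₂ t) t| ≤
      exp (α * (2 * V)) * (exp (α * V + 2 * α ^ 2) *
        (√2 * Δ + (4 * √π * R + exp γ * (V + 2)) * √t * M)) +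
      exp (3 * α * V + 4 * α ^ 2 + V ^ 2 / 4) *
        (4 * √π * R + (2 * π + V) * (exp γ * V)) * (2 * √t * M) := by
  have ht0 : 0 < t := ht.1
  have ht1 : t ≤ 1 := ht.2.trans hT1
  have hV := h₁.nonneg
  have hR0 : 0 ≤ R := le_trans (by positivity) (hR₁ 0)
  have hst : 0 < √t := sqrt_pos.2 ht0
  have hs0 {s w : ℝ → ℝ} (h : IsPath V s w) : s 0 = 0 := by simp [h.primitive]
  have hss : |s₁ t - s₂ t| ≤ M * t := by
    have := h₁.abs_sub_sub_le h₂ hM le_rfl ht0.le ht.2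
    simpa [hs0 h₁, hs0 h₂] using this
  have d2 {s w : ℝ → ℝ} (h : IsPath V s w) : |x - 2 * s t - x| ≤ 2 * V := by
    rw [show x - 2 * s t - x = -(2 * s t) by ring, abs_neg, abs_mul, abs_two]
    gcongr
    exact h.abs_le ht0.le ht1
  have A := weight_mul_abs_generatedField_sub_le hγ hα hT1 hf₁ hf₂ hR₁ hR₂ hΔ h₁ h₂ hM ht
    (x - 2 * s₁ t)
  have B := weight_mul_abs_generatedField_translate_le hγ hα hT1 hf₂ hR₂ h₂ ht (d2 h₁) (d2 h₂)
  have w1 := exp_weight_le hα (d2 h₁)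
  have hq : |x - 2 * s₁ t - (x - 2 * s₂ t)| / √t ≤ 2 * √t * M := by
    rw [div_le_iff₀ hst, show x - 2 * s₁ t - (x - 2 * s₂ t) = -(2 * (s₁ t - s₂ t)) by ring, abs_neg,
      abs_mul, abs_two]
    have : √t * √t = t := mul_self_sqrt ht0.le
    calc _ ≤ 2 * (M * t) := by gcongr
      _ = _ := by linear_combination (-2 * M) * this
  rw [show x - 2 * s₁ t + s₁ t = x - s₁ t by ring] at A
  rw [show x - 2 * s₂ t + s₂ t = x - s₂ t by ring] at B
  set a := generatedField γ T f₁ s₁ w₁ (x - s₁ t) t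
  set m := generatedField γ T f₂ s₂ w₂ (x - 2 * s₁ t + s₂ t) t
  set b := generatedField γ T f₂ s₂ w₂ (x - s₂ t) t
  calc exp (α * |x|) * |a - b| ≤ exp (α * |x|) * (|a - m| + |m - b|) := by
        gcongr; exact abs_sub_le _ _ _
    _ = exp (α * |x|) * |a - m| + exp (α * |x|) * |m - b| := mul_add _ _ _
    _ ≤ exp (α * (2 * V)) * exp (α * |x - 2 * s₁ t|) * |a - m| + exp (α * |x|) * |m - b| := by gcongr
    _ = exp (α * (2 * V)) * (exp (α * |x - 2 * s₁ t|) * |a - m|) + exp (α * |x|) * |m - b| := by ring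
    _ ≤ _ := by
      refine add_le_add (by gcongr) (B.trans ?_)
      gcongr

/-! ### Closing the estimate through the kinetic condition -/

lemma IsKinetics.exists_lipschitz {v₀ V₀ : ℝ} {g : ℝ → ℝ} (hg : IsKinetics v₀ V₀ g) :
    ∃ L, 0 ≤ L ∧ ∀ a b, 0 ≤ a → 0 ≤ b → |g a - g b| ≤ L * |a - b| := by
  obtain ⟨C, hC⟩ := hg.deriv_bdd
  refine ⟨C, (abs_nonneg _).trans (hC 0 (by simp)), fun a b ha hb => ?_⟩
  exact Convex.norm_image_sub_le_of_norm_derivWithin_le hg.differentiable hC (convex_Ici 0)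
    (x := b) (y := a) hb ha

lemma memC_and_wnorm_le {α C : ℝ} {f : ℝ → ℝ} (hf : Continuous f)
    (h : ∀ x, exp (α * |x|) * |f x| ≤ C) : MemC α f ∧ wnorm α f ≤ C :=
  ⟨⟨hf, C, by rintro _ ⟨x, rfl⟩; exact h x⟩, ciSup_le h⟩

lemma IsSolution.continuous_comp {γ σ : ℝ} {g f s v : ℝ → ℝ} {u : ℝ → ℝ → ℝ}
    (h : IsSolution γ g f σ u s v) {t : ℝ} (ht : t ∈ Ioo 0 σ) {k : ℝ → ℝ} (hk : Continuous k) :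
    Continuous fun x => u (k x) t :=
  h.cont.comp_continuous (f := fun x => (k x, t)) (by fun_prop) fun x => ⟨mem_univ _, ht.1.le, ht.2⟩

end Stefan

theorem mainTheorem5 (γ v₀ V₀ α : ℝ) (g : ℝ → ℝ) (hγ : 0 < γ)
    (hg : Stefan.IsKinetics v₀ V₀ g) (hα₀ : 0 ≤ α) (hα : α < Stefan.alphaSpace γ v₀ V₀) :
    ∃ c : ℝ, 0 < c ∧ ∀ R : ℝ, 0 < R → ∃ σ : ℝ, 0 < σ ∧
      ∀ f₁ f₂ : ℝ → ℝ, Stefan.MemC α f₁ → Stefan.MemC α f₂ →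
        Stefan.wnorm α f₁ ≤ R → Stefan.wnorm α f₂ ≤ R →
        ∀ (u₁ u₂ : ℝ → ℝ → ℝ) (s₁ s₂ v₁ v₂ : ℝ → ℝ),
          Stefan.IsSolution γ g f₁ σ u₁ s₁ v₁ → Stefan.IsSolution γ g f₂ σ u₂ s₂ v₂ →
          ∀ t ∈ Set.Ioo 0 σ,
            |v₁ t - v₂ t| ≤ c * Stefan.wnorm α (fun x => f₁ x - f₂ x) ∧
            (Stefan.MemC α (fun x => u₁ (x + s₁ t) t - u₂ (x + s₂ t) t) ∧
              Stefan.wnorm α (fun x => u₁ (x + s₁ t) t - u₂ (x + s₂ t) t)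
                ≤ c * Stefan.wnorm α (fun x => f₁ x - f₂ x)) ∧
            (Stefan.MemC α (fun x => u₁ (x - s₁ t) t - u₂ (x - s₂ t) t) ∧
              Stefan.wnorm α (fun x => u₁ (x - s₁ t) t - u₂ (x - s₂ t) t)
                ≤ c * Stefan.wnorm α (fun x => f₁ x - f₂ x)) := by
  open Stefan in
  obtain ⟨L, hL0, hL⟩ := hg.exists_lipschitz
  have hV0 := hg.pos_upper
  set E := exp (α * V₀ + 2 * α ^ 2) with hE
  set E₂ := exp (α * (2 * V₀)) with hE₂
  set E₃ := exp (3 * α * V₀ + 4 * α ^ 2 + V₀ ^ 2 / 4) with hE₃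
  have hEpos : 0 < E := exp_pos _
  have hE₂pos : 0 < E₂ := exp_pos _
  have hE₃pos : 0 < E₃ := exp_pos _
  set A₁ := E * √2 with hA₁
  have hA₁pos : 0 < A₁ := by positivity
  -- The terms `A₁` and `E₂ * A₁` are the data contributions in the two frames, and `2 * L * A₁`
  -- bounds `M / Δ`. None of them involves `R`.
  refine ⟨A₁ + E₂ * A₁ + 2 * L * A₁, by positivity, fun R hR => ?_⟩
  set A₂ := E * (4 * √π * R + exp γ * (V₀ + 2)) with hA₂
  have hA₂pos : 0 < A₂ := by positivity
  set A₃ := E₂ * A₂ + E₃ * (4 * √π * R + (2 * π + V₀) * (exp γ * V₀)) * 2 with hA₃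
  have hA₃pos : 0 < A₃ := by positivity
  -- With `σ = K⁻²`, every `t < σ` satisfies `√t K ≤ 1`. The summand `2 * L * A₂` makes the feedback
  -- factor at most `1/2`, `A₂` and `A₃` make the errors in the two frames at most `M`, and `1`
  -- forces `σ ≤ 1`.
  set K := 2 * L * A₂ + A₂ + A₃ + 1 with hK
  have hK1 : 1 ≤ K := by
    have : 0 ≤ 2 * L * A₂ + A₂ + A₃ := by positivity
    linarith
  have hKpos : 0 < K := by linarith
  refine ⟨(1 / K) ^ 2, by positivity, ?_⟩
  intro f₁ f₂ hf₁ hf₂ hR₁ hR₂ u₁ u₂ s₁ s₂ v₁ v₂ h₁ h₂ T hT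
  have hσ1 : (1 / K) ^ 2 ≤ 1 := pow_le_one₀ (by positivity) ((div_le_one hKpos).2 hK1)
  have hT1 : T ≤ 1 := hT.2.le.trans hσ1
  have sqrt_small : ∀ t ∈ Ioc 0 T, √t * K ≤ 1 := by
    intro t ht
    have h := sqrt_le_sqrt (ht.2.trans hT.2.le)
    rw [sqrt_sq (by positivity)] at h
    rwa [le_div_iff₀ hKpos] at h
  set Δ := wnorm α (fun x => f₁ x - f₂ x) with hΔ
  have bR₁ (x : ℝ) := (hf₁.abs_le x).trans hR₁
  have bR₂ (x : ℝ) := (hf₂.abs_le x).trans hR₂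
  have mΔ : MemC α (fun x => f₁ x - f₂ x) := by
    refine (memC_and_wnorm_le (C := R + R) (hf₁.1.sub hf₂.1) fun x => ?_).1
    calc _ ≤ exp (α * |x|) * (|f₁ x| + |f₂ x|) := by gcongr; exact abs_sub _ _
      _ ≤ _ := by rw [mul_add]; exact add_le_add (bR₁ x) (bR₂ x)
  have bΔ (x : ℝ) : exp (α * |x|) * |f₁ x - f₂ x| ≤ Δ := mΔ.abs_le x
  have hΔ0 : 0 ≤ Δ := le_trans (by positivity) (bΔ 0)
  obtain ⟨S₁, w₁, wc₁, wb₁, wv₁, Sp₁, Ss₁, rep₁⟩ := h₁.representation hγ hg hα₀ hf₁ hT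
  obtain ⟨S₂, w₂, wc₂, wb₂, wv₂, Sp₂, Ss₂, rep₂⟩ := h₂.representation hγ hg hα₀ hf₂ hT
  have p₁ : IsPath V₀ S₁ w₁ := ⟨wc₁, wb₁, Sp₁⟩
  have p₂ : IsPath V₀ S₂ w₂ := ⟨wc₂, wb₂, Sp₂⟩
  obtain ⟨τ₀, hτ₀, hmax⟩ := isCompact_Icc.exists_isMaxOn (nonempty_Icc.2 hT.1.le)
    ((wc₁.sub wc₂).abs.continuousOn (s := Icc 0 T))
  set M := |w₁ τ₀ - w₂ τ₀| with hM
  have hM0 : 0 ≤ M := abs_nonneg _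
  have bM : ∀ τ ∈ Icc 0 T, |w₁ τ - w₂ τ| ≤ M := fun τ hτ => hmax hτ
  -- Both fields carry the same factor `e^{γ t} ≥ 1`, so dropping it only decreases the difference.
  have scale (t : ℝ) (ht : t ∈ Ioc 0 T) (x y : ℝ) : |u₁ x t - u₂ y t| ≤
      |generatedField γ T f₁ S₁ w₁ x t - generatedField γ T f₂ S₂ w₂ y t| := by
    unfold generatedField
    rw [← rep₁ x t ⟨ht.1.le, ht.2⟩, ← rep₂ y t ⟨ht.1.le, ht.2⟩, ← mul_sub, abs_mul,
      abs_of_pos (exp_pos _)]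
    exact le_mul_of_one_le_left (abs_nonneg _) (one_le_exp (mul_nonneg hγ.le ht.1.le))
  have front (t : ℝ) (ht : t ∈ Ioc 0 T) (y : ℝ) :
      exp (α * |y|) * |u₁ (y + s₁ t) t - u₂ (y + s₂ t) t| ≤ A₁ * Δ + A₂ * √t * M := by
    have htI : t ∈ Icc 0 T := ⟨ht.1.le, ht.2⟩
    rw [← Ss₁ t htI, ← Ss₂ t htI]
    refine (mul_le_mul_of_nonneg_left (scale t ht _ _) (exp_pos _).le).trans ?_
    refine (weight_mul_abs_generatedField_sub_le hγ.le hα₀ hT1 hf₁.1 hf₂.1 bR₁ bR₂ bΔ p₁ p₂ bM ht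
      y).trans (le_of_eq ?_)
    rw [hA₁, hA₂]; ring
  -- The position `y = 0` of the moving frame is the interface, where the kinetic condition returns
  -- the velocities and the weight equals `1`.
  have speed : ∀ τ ∈ Ioc 0 T, |w₁ τ - w₂ τ| ≤ L * (A₁ * Δ) + M / 2 := by
    intro τ hτ
    have hτσ : τ ∈ Ioo 0 ((1 / K) ^ 2) := ⟨hτ.1, hτ.2.trans_lt hT.2⟩
    rw [wv₁ τ hτ, wv₂ τ hτ, ← h₁.kinetic τ hτσ, ← h₂.kinetic τ hτσ]
    refine (hL _ _ (h₁.interface_nonneg τ hτσ) (h₂.interface_nonneg τ hτσ)).trans ?_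
    have h0 := front τ hτ 0
    simp only [abs_zero, mul_zero, exp_zero, one_mul, zero_add] at h0
    have h3 : L * A₂ * √τ ≤ 1 / 2 := by
      have h4 := sqrt_small τ hτ
      have : √τ * (2 * L * A₂) ≤ √τ * K := by
        gcongr
        rw [hK]; linarith
      linarith
    calc _ ≤ L * (A₁ * Δ + A₂ * √τ * M) := by gcongr
      _ = L * (A₁ * Δ) + (L * A₂ * √τ) * M := by ring
      _ ≤ L * (A₁ * Δ) + (1 / 2) * M := by gcongr
      _ = _ := by ring
  have hMle : M ≤ 2 * L * A₁ * Δ := by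
    -- The maximum `M` may be attained at `τ₀ = 0`, where the kinetic condition is not available;
    -- continuity extends the bound there.
    have hcl : Icc 0 T ⊆ {τ | |w₁ τ - w₂ τ| ≤ L * (A₁ * Δ) + M / 2} := by
      rw [← closure_Ioc hT.1.ne]
      exact (isClosed_le (wc₁.sub wc₂).abs continuous_const).closure_subset_iff.2 speed
    have h5 : M ≤ L * (A₁ * Δ) + M / 2 := hcl hτ₀
    linarith
  have hTT : T ∈ Ioc 0 T := ⟨hT.1, le_rfl⟩
  have hTI : T ∈ Icc 0 T := ⟨hT.1.le, le_rfl⟩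
  have hsK := sqrt_small T hTT
  have small (A : ℝ) (hA : A ≤ K) : A * √T * M ≤ M := by
    have : A * √T ≤ 1 := by
      have := mul_le_mul_of_nonneg_left hA (sqrt_nonneg T)
      linarith
    exact mul_le_of_le_one_left hM0 this
  have hLA : 0 ≤ 2 * L * A₂ := by positivity
  have hEAΔ : 0 ≤ E₂ * A₁ * Δ := by positivity
  have hAΔ : 0 ≤ A₁ * Δ := by positivity
  refine ⟨?_, ?_, ?_⟩
  · rw [← wv₁ T hTT, ← wv₂ T hTT]
    have := bM T hTI
    linarith
  · refine memC_and_wnorm_le ((h₁.continuous_comp hT (by fun_prop)).sub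
      (h₂.continuous_comp hT (by fun_prop))) fun y => (front T hTT y).trans ?_
    have := small A₂ (by rw [hK]; linarith)
    linarith
  · refine memC_and_wnorm_le ((h₁.continuous_comp hT (by fun_prop)).sub
      (h₂.continuous_comp hT (by fun_prop))) fun y => ?_
    rw [← Ss₁ T hTI, ← Ss₂ T hTI]
    refine (mul_le_mul_of_nonneg_left (scale T hTT _ _) (exp_pos _).le).trans ?_
    refine (weight_mul_abs_generatedField_reflected_sub_le hγ.le hα₀ hT1 hf₁.1 hf₂.1 bR₁ bR₂ bΔ p₁ p₂
      bM hTT y).trans ?_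
    have h6 := small A₃ (by rw [hK]; linarith)
    have e : exp (α * (2 * V₀)) * (exp (α * V₀ + 2 * α ^ 2) *
        (√2 * Δ + (4 * √π * R + exp γ * (V₀ + 2)) * √T * M)) +
      exp (3 * α * V₀ + 4 * α ^ 2 + V₀ ^ 2 / 4) *
        (4 * √π * R + (2 * π + V₀) * (exp γ * V₀)) * (2 * √T * M) = E₂ * A₁ * Δ + A₃ * √T * M := by
      rw [hA₃, hA₂, hA₁]; ring
    rw [e]
    linarith

end
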